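/- Let $\Omega>0$, let $\mathbf R,\mathbf G_p,\mathbf G_q\in\mathbb R^3$, put $\mathbf G_\nu=\mathbf G_q-\mathbf G_p$, $G_p=\|\mathbf G_p\|$, $G_q=\|\mathbf G_q\|$, and let $\varphi_p(\mathbf r)=\Omega^{-1/2}e^{i\mathbf G_p\cdot\mathbf r}$, $\varphi_q(\mathbf r)=\Omega^{-1/2}e^{i\mathbf G_q\cdot\mathbf r}$ be plane waves. Given $l_{\max},n\ge 0$, real radial functions $\beta_i^{(l)}$ on $[0,\infty)$ and real coefficients $B^{(l)}_{ij}$ ($0\le l\le l_{\max}$, $1\le i,j\le n$), put $\beta_i^{(lm)}(\mathbf r)=\beta_i^{(l)}(\|\mathbf r-\mathbf R\|)\,Y_{lm}\!\big(\tfrac{\mathbf r-\mathbf R}{\|\mathbf r-\mathbf R\|}\big)$ with $Y_{lm}$ the orthonormal spherical harmonics, and $$u^{\mathrm{NL}}_{pq}(\mathbf R)=\sum_{l=0}^{l_{\max}}\sum_{m=-l}^{l}\sum_{i,j=1}^{n}\langle\varphi_p|\beta_i^{(lm)}\rangle\,B^{(l)}_{ij}\,\langle\beta_j^{(lm)}|\varphi_q\rangle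 ,\qquad \langle f|g\rangle=\int_{\mathbb R^3}\overline{f(\mathbf r)}\,g(\mathbf r)\,d\mathbf r .$$ (a) If every $r\mapsto r^2\beta_i^{(l)}(r)$ is integrable on $(0,\infty)$, then $$u^{\mathrm{NL}}_{pq}(\mathbf R)=\frac{4\pi}{\Omega}\,e^{i\mathbf G_\nu\cdot\mathbf R}\sum_{l=0}^{l_{\max}}(2l+1)\,P_l(\hat{\mathbf G}_p\cdot\hat{\mathbf G}_q)\sum_{i,j}\langle p|i\rangle_l\,B^{(l)}_{ij}\,\langle j|q\rangle_l ,$$ where $P_l$ is the Legendre polynomial, $\hat{\mathbf G}=\mathbf G/\|\mathbf G\|$ (with $\hat{\mathbf 0}=\mathbf 0$), $\langle p|i\rangle_l=\int_0^\infty r^2 j_l(G_p r)\,\beta_i^{(l)}(r)\,dr$, $\langle j|q\rangle_l=\int_0^\infty r^2 j_l(G_q r)\,\beta_j^{(l)}(r)\,dr$, and $j_l$ is the spherical Bessel function of the first kind. (b) Let $l_{\max}=2$, with one Hartwigsen-Goedecker-Hutter projector per angular momentum ($n=1$): $$\beta_1^{(l)}(r)=A_l^1\,r^{l}\,e^{-\frac12(r/r_l)^2},\qquad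 A_l^1=\frac{\sqrt2}{r_l^{\,l+3/2}\,\Gamma(l+\tfrac32)},\qquad r_l>0\quad(l=0,1,2).$$ Then, with $B_l:=B_{11}^{(l)}$, $$u^{\mathrm{NL}}_{pq}(\mathbf R)=\frac{4\pi}{\Omega}e^{i\mathbf G_\nu\cdot\mathbf R}\Big\{4B_0r_0^3e^{-(G_p^2+G_q^2)r_0^2/2}+\frac{16B_1r_1^5}{3}(\mathbf G_p\cdot\mathbf G_q)e^{-(G_p^2+G_q^2)r_1^2/2}+\Big[\frac{32B_2r_2^7}{15}(\mathbf G_p\cdot\mathbf G_q)^2-\frac{32B_2r_2^7}{45}(G_pG_q)^2\Big]e^{-(G_p^2+G_q^2)r_2^2/2}\Big\}.$$ -/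

import Mathlib

open MeasureTheory Set
open scoped ComplexConjugate Nat

noncomputable section

namespace PlaneWavePP

/-- Three-dimensional Euclidean space, in which positions and reciprocal vectors live. -/
abbrev R3 := EuclideanSpace ℝ (Fin 3)

/-- The Legendre polynomial `P_l`, by Rodrigues' formula
`P_l(x) = (1 / (2^l l!)) (d/dx)^l (x^2 - 1)^l`. -/
def legendreP (l : ℕ) : Polynomial ℝ :=
  Polynomial.C (1 / ((2 : ℝ) ^ l * (l ! : ℝ))) *
    Polynomial.derivative^[l] ((Polynomial.X ^ 2 - 1) ^ l)

/-- The spherical harmonic `Y_{lm}` (`-l ≤ m ≤ l`), orthonormal on the sphere and with the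
Condon-Shortley phase, as a function of the unit vector
`n = (sin θ cos φ, sin θ sin φ, cos θ)`.
For `m ≥ 0` it is
`√((2l+1)/(4π) · (l-m)!/(l+m)!) P_l^m(cos θ) e^{imφ}` with the associated Legendre function
`P_l^m(x) = (-1)^m (1 - x^2)^{m/2} P_l^{(m)}(x)`, and `Y_{l,-m} = (-1)^m conj Y_{lm}`; the factor
`(sin θ)^|m| e^{imφ}` is written as `(n₀ ± i n₁)^|m|`. -/
def sphericalHarmonic (l : ℕ) (m : ℤ) (n : R3) : ℂ :=
  (if 0 ≤ m then (-1 : ℂ) ^ m.natAbs else 1) *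
    (Real.sqrt ((2 * l + 1) / (4 * Real.pi) *
      (((l - m.natAbs)! : ℕ) / ((l + m.natAbs)! : ℕ))) : ℝ) *
    ((Polynomial.derivative^[m.natAbs] (legendreP l)).eval (n 2) : ℝ) *
    (if 0 ≤ m then (n 0 : ℂ) + Complex.I * (n 1 : ℂ)
      else (n 0 : ℂ) - Complex.I * (n 1 : ℂ)) ^ m.natAbs

/-- The spherical Bessel function of the first kind `j_l`, by Poisson's integral
`j_l(x) = x^l / (2^{l+1} l!) ∫_{-1}^{1} cos(x t) (1 - t^2)^l dt`
(so `j_0(x) = sin x / x` for `x ≠ 0`, and the value at `0` is the limit). -/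
def sphericalBessel (l : ℕ) (x : ℝ) : ℝ :=
  x ^ l / (2 ^ (l + 1) * (l ! : ℝ)) *
    ∫ t in (-1 : ℝ)..1, Real.cos (x * t) * (1 - t ^ 2) ^ l

/-- The unit vector in the direction of `x` (and `0` for `x = 0`). -/
def dir (x : R3) : R3 := ‖x‖⁻¹ • x

/-- The plane wave `φ_G(x) = Ω^{-1/2} e^{i G · x}` for a cell of volume `Ω`. -/
def planeWave (Ω : ℝ) (G : R3) (x : R3) : ℂ :=
  ((1 / Real.sqrt Ω : ℝ) : ℂ) * Complex.exp (Complex.I * ((inner ℝ G x : ℝ) : ℂ))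

/-- The projector function with radial part `β` and angular part `Y_{lm}`, centred at `R`. -/
def projector (β : ℝ → ℝ) (l : ℕ) (m : ℤ) (R : R3) (x : R3) : ℂ :=
  (β ‖x - R‖ : ℂ) * sphericalHarmonic l m (dir (x - R))

/-- The overlap `⟨f | g⟩ = ∫ conj (f x) g x dx` over the whole space. -/
def braket (f g : R3 → ℂ) : ℂ := ∫ x, conj (f x) * g x

/-- The matrix element `⟨φ_p | u^NL | φ_q⟩` between the plane waves of reciprocal vectors `Gp`, `Gq`
of the separable non-local operator
`u^NL = ∑_{l ≤ lmax} ∑_{|m| ≤ l} ∑_{i,j} |β_i^{(lm)}⟩ B_{ij}^{(l)} ⟨β_j^{(lm)}|` of an ion at `R`,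
with `n` projectors per angular momentum. -/
def nonlocalElement (Ω : ℝ) (lmax n : ℕ) (β : ℕ → Fin n → ℝ → ℝ)
    (B : ℕ → Matrix (Fin n) (Fin n) ℝ) (R Gp Gq : R3) : ℂ :=
  ∑ l ∈ Finset.range (lmax + 1), ∑ m ∈ Finset.Icc (-(l : ℤ)) (l : ℤ), ∑ i, ∑ j,
    braket (planeWave Ω Gp) (projector (β l i) l m R) * (B l i j : ℂ) *
      braket (projector (β l j) l m R) (planeWave Ω Gq)

/-- The radial overlap `∫_0^∞ r^2 j_l(G r) β(r) dr`. -/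
def radialOverlap (l : ℕ) (G : ℝ) (β : ℝ → ℝ) : ℝ :=
  ∫ r in Ioi (0 : ℝ), r ^ 2 * sphericalBessel l (G * r) * β r

/-- The constant `A_l^i = √2 / (ρ^{l + (4i-1)/2} Γ(l + (4i-1)/2))`, where `ρ` is the radius `r_l`. -/
def hghConst (ρ : ℝ) (l i : ℕ) : ℝ :=
  Real.sqrt 2 /
    (ρ ^ ((l : ℝ) + (4 * (i : ℝ) - 1) / 2) * Real.Gamma ((l : ℝ) + (4 * (i : ℝ) - 1) / 2))

/-- The Hartwigsen-Goedecker-Hutter radial projector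
`β_i^{(l)}(r) = A_l^i r^{l+2i-2} exp(-(r/ρ)^2/2)`, `i ≥ 1`, where `ρ` is the radius `r_l`. -/
def hghRadial (ρ : ℝ) (l i : ℕ) (r : ℝ) : ℝ :=
  hghConst ρ l i * r ^ (l + 2 * i - 2) * Real.exp (-(1 / 2) * (r / ρ) ^ 2)

end PlaneWavePP

end

/-! Translating by `R` turns each braket into a phase times the Fourier integral of `β(‖x‖)
Y_lm(x̂)`. The individual integrals are never evaluated: only their sum over `m` is needed. Two
facts collapse it.

The addition theorem `sum_sphericalHarmonic_mul_conj` replaces `∑_m Y_lm(x) conj Y_lm(y)` by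
`(2l+1)/(4π) P_l(x·y)`. Its proof Taylor-expands `P_l` around the product of the third coordinates
and sorts the terms by azimuthal frequency. As a polynomial in one variable, each frequency
coefficient satisfies the equation of `P_l^{(m)}`, because the operator telescopes on its terms. A
polynomial solution is determined by its value at `1`, so the coefficient is a multiple of
`P_l^{(m)}`.

The Funk-Hecke formula `integral_phase_mul_radial_mul_legendreP_inner` says that integrating
`P_l(x̂·y)` against a radial function and a plane wave along `e` reproduces `P_l(e·y)`, with factor
`4π(-i)^l` times the radial overlap. With `e` moved to the third axis, rotations about that axis
kill every `m ≠ 0`. The `m = 0` term is one-dimensional by Archimedes' theorem, and Rodrigues'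
formula with `l` integrations by parts gives Poisson's integral for `j_l`. Using both facts for `p`
and for `q` gives (a), where `(-i)^l` and `i^l` cancel.

For (b), `x^{-l} j_l(x)` obeys a first-order recurrence in `l`. Integration by parts against a
Gaussian lowers `l` to the Fourier transform of the Gaussian, and values of `Γ` at half-integers
supply the constants. -/

noncomputable section

namespace PlaneWavePP

/-! ### Legendre polynomials and the addition theorem -/

section Legendre

open Polynomial

/-- The operator `(1 - X²) q'' - 2 (m + 1) X q' + μ q`, whose kernel contains the derivatives of
Legendre polynomials. -/
def ultraOp (m : ℕ) (μ : ℝ) (q : ℝ[X]) : ℝ[X] :=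
  (1 - X ^ 2) * derivative (derivative q) - C (2 * ((m : ℝ) + 1)) * X * derivative q + C μ * q

theorem derivative_ultraOp (m : ℕ) (μ : ℝ) (q : ℝ[X]) :
    derivative (ultraOp m μ q) = ultraOp (m + 1) (μ - 2 * ((m : ℝ) + 1)) (derivative q) := by
  simp only [ultraOp, derivative_mul, derivative_one, derivative_X_pow, derivative_C,
    derivative_X, map_sub, map_mul, map_add, Nat.cast_add,
    Nat.cast_one, map_one, map_ofNat, map_natCast]
  norm_num
  ring

/-- The leading coefficient vanishes at `1`, so there the equation reads `2(m+1) q'(1) = μ q(1)`.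
Differentiation keeps the form of the equation, so the argument repeats for `q'`. -/
theorem iterate_derivative_eval_one_of_ultraOp_eq_zero (k : ℕ) :
    ∀ (m : ℕ) (μ : ℝ) (q : ℝ[X]), ultraOp m μ q = 0 → q.eval 1 = 0 →
      (derivative^[k] q).eval 1 = 0 := by
  induction k with
  | zero => intro m μ q _ h1; simpa using h1
  | succ k ih =>
    intro m μ q h h1
    rw [Function.iterate_succ_apply]
    refine ih (m + 1) (μ - 2 * ((m : ℝ) + 1)) _ ?_ ?_
    · rw [← derivative_ultraOp, h, derivative_zero]
    · have := congrArg (Polynomial.eval 1) h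
      simp only [ultraOp, eval_add, eval_sub, eval_mul, eval_one, eval_pow, eval_X, eval_C, h1,
        eval_zero] at this
      have hm : (0 : ℝ) < 2 * ((m : ℝ) + 1) := by positivity
      have h2 : 2 * ((m : ℝ) + 1) * eval 1 (derivative q) = 0 := by linarith
      exact (mul_eq_zero.1 h2).resolve_left hm.ne'

/-- Since `1` is a singular point of the equation, one initial value suffices: every Taylor
coefficient at `1` vanishes. -/
theorem eq_zero_of_ultraOp_eq_zero {m : ℕ} {μ : ℝ} {q : ℝ[X]} (h : ultraOp m μ q = 0)
    (h1 : q.eval 1 = 0) : q = 0 := by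
  refine eq_zero_of_hasseDeriv_eq_zero q 1 fun k => ?_
  have hk := iterate_derivative_eval_one_of_ultraOp_eq_zero k m μ q h h1
  have : (k ! : ℝ) * (hasseDeriv k q).eval 1 = 0 := by
    rw [← hk, ← factorial_smul_hasseDeriv]
    simp
  exact (mul_eq_zero.1 this).resolve_left (by positivity)

/-- For `w = (X² - 1)^l`, this is `(X² - 1) w' = 2 l X w` differentiated `k + 1` times. -/
theorem iterate_derivative_sq_sub_one_pow (l k : ℕ) :
    (X ^ 2 - 1 : ℝ[X]) * derivative^[k + 2] ((X ^ 2 - 1) ^ l)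
      + C (2 * ((k : ℝ) + 1) - 2 * l) * X * derivative^[k + 1] ((X ^ 2 - 1) ^ l)
      + C (((k : ℝ) - 2 * l) * (k + 1)) * derivative^[k] ((X ^ 2 - 1) ^ l) = 0 := by
  induction k with
  | zero =>
    have h : (X ^ 2 - 1 : ℝ[X]) * derivative ((X ^ 2 - 1) ^ l) =
        2 * (l : ℝ[X]) * X * (X ^ 2 - 1) ^ l := by
      rcases l with _ | l
      · simp
      · rw [derivative_pow]
        simp only [Nat.add_sub_cancel, derivative_sub, derivative_X_pow, derivative_one,
          Nat.cast_add, Nat.cast_one, map_add, map_natCast, map_one]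
        norm_num
        ring
    have h' := congrArg derivative h
    simp only [derivative_mul, derivative_sub, derivative_X_pow, derivative_one, derivative_X,
      derivative_natCast, derivative_ofNat] at h'
    simp only [Function.iterate_succ_apply', Function.iterate_zero_apply, map_sub, map_mul,
      map_add, map_ofNat, map_natCast, map_one, Nat.cast_zero, map_zero, Nat.cast_ofNat] at h' ⊢
    simp only [Nat.add_one_sub_one, pow_one] at h'
    linear_combination h'
  | succ k ih =>
    have h' := congrArg derivative ih
    simp only [derivative_add, derivative_mul, derivative_sub, derivative_X_pow, derivative_one,
      derivative_X, derivative_C, ← Function.iterate_succ_apply', derivative_zero] at h'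
    simp only [map_sub, map_mul, map_add, map_ofNat, map_natCast, map_one, Nat.cast_add,
      Nat.cast_ofNat, Nat.cast_one, Nat.add_one_sub_one, pow_one] at h' ⊢
    linear_combination h'

theorem ultraOp_iterate_derivative_legendreP (l m : ℕ) :
    ultraOp m (((l : ℝ) - m) * (l + m + 1)) (derivative^[m] (legendreP l)) = 0 := by
  -- At order `m + l` the coefficients become `2(m+1)` and `(m-l)(l+m+1)`, which is the operator up
  -- to sign.
  have h := iterate_derivative_sq_sub_one_pow l (m + l)
  have e : ∀ j, derivative^[m + j] (legendreP l) =
      C (1 / ((2 : ℝ) ^ l * (l ! : ℝ))) * derivative^[m + l + j] ((X ^ 2 - 1) ^ l) := by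
    intro j
    rw [legendreP, iterate_derivative_C_mul, ← Function.iterate_add_apply]
    rw [show m + j + l = m + l + j by omega]
  have e0 := e 0
  have e1 := e 1
  have e2 := e 2
  simp only [add_zero] at e0
  rw [ultraOp, ← Function.iterate_succ_apply' (f := derivative),
    ← Function.iterate_succ_apply' (f := derivative)]
  rw [show (m.succ).succ = m + 2 from rfl, show m.succ = m + 1 from rfl, e0, e1, e2]
  simp only [map_sub, map_mul, map_add, map_ofNat, map_natCast, map_one, Nat.cast_add] at h ⊢
  linear_combination (-C (1 / ((2 : ℝ) ^ l * (l ! : ℝ)))) * h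

theorem eval_one_iterate_derivative_X_sub_one_pow_mul (k : ℕ) :
    ∀ q : ℝ[X], (derivative^[k] ((X - 1) ^ k * q)).eval 1 = k ! * q.eval 1 := by
  induction k with
  | zero => intro q; simp
  | succ k ih =>
    intro q
    have : derivative ((X - 1) ^ (k + 1) * q) =
        (X - 1) ^ k * (C ((k : ℝ) + 1) * q + (X - 1) * derivative q) := by
      simp only [derivative_mul, derivative_pow, derivative_sub, derivative_X, derivative_one,
        Nat.cast_add, Nat.cast_one, Nat.add_sub_cancel]
      ring
    rw [Function.iterate_succ_apply, this, ih]
    simp [Nat.factorial_succ]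
    ring

theorem legendreP_eval_one (l : ℕ) : (legendreP l).eval 1 = 1 := by
  have h : ((X : ℝ[X]) ^ 2 - 1) ^ l = (X - 1) ^ l * (X + 1) ^ l := by
    rw [← mul_pow]; congr 1; ring
  rw [legendreP, h, eval_C_mul, eval_one_iterate_derivative_X_sub_one_pow_mul]
  simp only [eval_pow, eval_add, eval_X, eval_one]
  norm_num
  field_simp

theorem iterate_derivative_legendreP_eval_one_succ (l k : ℕ) :
    2 * ((k : ℝ) + 1) * (derivative^[k + 1] (legendreP l)).eval 1 =
      ((l : ℝ) - k) * (l + k + 1) * (derivative^[k] (legendreP l)).eval 1 := by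
  have h := congrArg (Polynomial.eval 1) (ultraOp_iterate_derivative_legendreP l k)
  simp only [ultraOp, eval_add, eval_sub, eval_mul, eval_one, eval_pow, eval_X, eval_C,
    eval_zero] at h
  rw [Function.iterate_succ_apply']
  linarith

/-- Solves the recurrence that the equation imposes at `1`; it fixes the constant in the addition
theorem. -/
theorem iterate_derivative_legendreP_eval_one (l k : ℕ) (hk : k ≤ l) :
    (derivative^[k] (legendreP l)).eval 1 * (2 ^ k * k ! * (l - k)! : ℝ) = (l + k)! := by
  induction k with
  | zero => simp [legendreP_eval_one]
  | succ k ih =>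
    obtain ⟨d, rfl⟩ : ∃ d, l = k + 1 + d := ⟨l - (k + 1), by omega⟩
    have ih := ih (by omega)
    have h := iterate_derivative_legendreP_eval_one_succ (k + 1 + d) k
    have e1 : k + 1 + d - k = d + 1 := by omega
    have e2 : k + 1 + d - (k + 1) = d := by omega
    rw [e1] at ih
    rw [e2, show k + 1 + d + (k + 1) = (k + 1 + d + k) + 1 by ring]
    rw [Nat.factorial_succ] at ih
    rw [Nat.factorial_succ, Nat.factorial_succ]
    push_cast at h ih ⊢
    rw [← ih]
    linear_combination (2 ^ k * (k ! : ℝ) * (d ! : ℝ)) * h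

theorem iterate_derivative_legendreP_eq_zero {l k : ℕ} (hk : l < k) :
    derivative^[k] (legendreP l) = 0 := by
  obtain ⟨d, rfl⟩ : ∃ d, k = d + l + 1 := ⟨k - l - 1, by omega⟩
  rw [legendreP, iterate_derivative_C_mul, ← Function.iterate_add_apply]
  rw [iterate_derivative_eq_zero, mul_zero]
  have h2 : ((X : ℝ[X]) ^ 2 - 1).natDegree ≤ 2 := by
    compute_degree
  calc (((X : ℝ[X]) ^ 2 - 1) ^ l).natDegree ≤ l * ((X : ℝ[X]) ^ 2 - 1).natDegree :=
        natDegree_pow_le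
    _ ≤ l * 2 := Nat.mul_le_mul_left _ h2
    _ < _ := by omega

end Legendre

/-! ### Fourier coefficients in the addition theorem -/

section Addition

open Polynomial

theorem iterate_derivative_legendreP_comp_ode (l k : ℕ) (s : ℝ) :
    (1 - C s ^ 2 * X ^ 2 : ℝ[X]) * (derivative^[k + 2] (legendreP l)).comp (C s * X)
      - 2 * ((k : ℝ[X]) + 1) * (C s * X) * (derivative^[k + 1] (legendreP l)).comp (C s * X)
      + ((l : ℝ[X]) - (k : ℝ[X])) * ((l : ℝ[X]) + (k : ℝ[X]) + 1) * (derivative^[k] (legendreP l)).comp (C s * X) = 0 := by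
  have h := congrArg (fun q : ℝ[X] => q.comp (C s * X))
    (ultraOp_iterate_derivative_legendreP l k)
  simp only [ultraOp, ← Function.iterate_succ_apply' (f := derivative), add_comp, sub_comp,
    mul_comp, one_comp, pow_comp, X_comp, C_comp, zero_comp] at h
  simp only [map_mul, map_add, map_sub, map_one, map_ofNat, map_natCast] at h
  linear_combination h

theorem derivative_iterate_derivative_legendreP_comp (l k : ℕ) (s : ℝ) :
    derivative ((derivative^[k] (legendreP l)).comp (C s * X)) =
      C s * (derivative^[k + 1] (legendreP l)).comp (C s * X) := by
  rw [derivative_comp, Function.iterate_succ_apply']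
  simp

/-- The `b`-th term of the `m`-th Fourier coefficient of `P_l(t s + √(1-t²)√(1-s²) cos φ)`, as a
polynomial in `t`. -/
def additionTerm (l m : ℕ) (s : ℝ) (b : ℕ) : ℝ[X] :=
  C ((1 - s ^ 2) ^ b / ((m + b)! * b ! * 4 ^ b)) * (1 - X ^ 2) ^ b *
    (derivative^[m + 2 * b] (legendreP l)).comp (C s * X)

/-- The telescoping remainders for `ultraOp` applied to `additionTerm`. -/
def additionRem (l m : ℕ) (s : ℝ) : ℕ → ℝ[X]
  | 0 => 0
  | b + 1 => C ((1 - s ^ 2) ^ (b + 1) / ((m + b)! * b ! * 4 ^ b)) * (1 - X ^ 2) ^ b *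
      (derivative^[m + 2 * (b + 1)] (legendreP l)).comp (C s * X)

/-- Since `(1-X²)s² - (1-s²X²) = -(1-s²)`, the Legendre equation at argument `sX` leaves a term in
`P_l^{(m+2b+2)}`. Differentiating `(1-X²)^b` leaves one in `P_l^{(m+2b)}`. The weights `1/((m+b)! b!
4^b)` match these between neighbours. -/
theorem ultraOp_additionTerm (l m : ℕ) (s : ℝ) (b : ℕ) :
    ultraOp m (((l : ℝ) - m) * (l + m + 1)) (additionTerm l m s b) =
      additionRem l m s b - additionRem l m s (b + 1) := by
  rcases b with _ | b
  · have h := iterate_derivative_legendreP_comp_ode l m s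
    simp only [ultraOp, additionTerm, additionRem, derivative_mul, derivative_C, pow_zero,
      mul_zero, add_zero, mul_one, zero_mul, zero_add, derivative_one,
      derivative_iterate_derivative_legendreP_comp, pow_one, div_eq_mul_inv, map_mul, map_sub,
      map_add, map_one, map_pow, map_ofNat, map_natCast] at h ⊢
    linear_combination C ((m ! : ℝ) * (0 ! : ℕ))⁻¹ * h
  · have h := iterate_derivative_legendreP_comp_ode l (m + 2 * (b + 1)) s
    -- Multiplying by `1 - X²` avoids the exponent `b - 1`, so that `b = 0` needs no separate
    -- treatment below.
    have hE : (1 - X ^ 2 : ℝ[X]) * derivative ((1 - X ^ 2) ^ b) =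
        (b : ℝ[X]) * (1 - X ^ 2) ^ b * (-2 * X) := by
      rcases b with _ | b
      · simp
      · rw [derivative_pow]
        simp only [Nat.add_sub_cancel, derivative_sub, derivative_X_pow, derivative_one,
          Nat.cast_add, Nat.cast_one, map_add, map_natCast, map_one]
        norm_num
        ring
    set κ : ℝ := (1 - s ^ 2) ^ (b + 1) / ((m + (b + 1))! * (b + 1)! * 4 ^ (b + 1)) with hκ
    have hc : (1 - s ^ 2) ^ (b + 1) / ((m + b)! * b ! * 4 ^ b) =
        κ * (4 * ((b : ℝ) + 1) * (m + b + 1)) := by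
      rw [hκ, ← add_assoc, Nat.factorial_succ, Nat.factorial_succ]
      push_cast
      field_simp
      ring
    have hc' : (1 - s ^ 2) ^ (b + 1 + 1) / ((m + (b + 1))! * (b + 1)! * 4 ^ (b + 1)) =
        κ * (1 - s ^ 2) := by
      rw [hκ]; ring
    rw [additionTerm, additionRem, additionRem, hc, hc', ← hκ, ultraOp]
    rw [show m + 2 * (b + 1 + 1) = m + 2 * (b + 1) + 2 by ring]
    have hA : derivative ((1 - X ^ 2 : ℝ[X]) ^ (b + 1)) =
        ((b : ℝ[X]) + 1) * (1 - X ^ 2) ^ b * (-2 * X) := by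
      rw [derivative_pow]
      simp only [Nat.add_sub_cancel, derivative_sub, derivative_X_pow, derivative_one,
          Nat.cast_add, Nat.cast_one, map_add, map_natCast, map_one]
      norm_num
    simp only [derivative_mul, derivative_C, hA, derivative_iterate_derivative_legendreP_comp,
      derivative_add, derivative_natCast, derivative_one, derivative_X, derivative_neg,
      derivative_ofNat, zero_mul, zero_add, mul_one, add_zero]
    simp only [map_mul, map_sub, map_add, map_one, map_pow, map_ofNat, map_natCast, Nat.cast_add,
      Nat.cast_mul, Nat.cast_ofNat, Nat.cast_one] at h ⊢
    generalize derivative ((1 - X ^ 2 : ℝ[X]) ^ b) = E at hE ⊢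
    linear_combination (C κ * ((b : ℝ[X]) + 1) * (-2 * X) *
      (derivative^[m + 2 * (b + 1)] (legendreP l)).comp (C s * X)) * hE +
      (C κ * (1 - X ^ 2) ^ (b + 1) : ℝ[X]) * h

theorem ultraOp_sum {ι : Type*} (m : ℕ) (μ : ℝ) (S : Finset ι) (f : ι → ℝ[X]) :
    ultraOp m μ (∑ i ∈ S, f i) = ∑ i ∈ S, ultraOp m μ (f i) := by
  simp only [ultraOp, derivative_sum, Finset.mul_sum, Finset.sum_add_distrib,
    Finset.sum_sub_distrib]

/-- Both sides solve the same equation: on the left the sum telescopes, and the last remainder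
contains a derivative of order above `l`. At `1` only the `b = 0` term survives, so the values there
agree. -/
theorem sum_additionTerm {l m N : ℕ} (hm : m ≤ l) (hN : l < N) (s : ℝ) :
    ∑ b ∈ Finset.range N, additionTerm l m s b =
      C (2 ^ m * (l - m)! / (l + m)! * (derivative^[m] (legendreP l)).eval s) *
        derivative^[m] (legendreP l) := by
  rw [← sub_eq_zero]
  obtain ⟨M, rfl⟩ : ∃ M, N = M + 1 := ⟨N - 1, by omega⟩
  have hlin : ∀ (p q : ℝ[X]) (c μ : ℝ),
      ultraOp m μ (p - C c * q) = ultraOp m μ p - C c * ultraOp m μ q := by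
    intro p q c μ
    simp only [ultraOp, derivative_sub, derivative_mul, derivative_C, zero_mul, zero_add]
    ring
  refine eq_zero_of_ultraOp_eq_zero (m := m) (μ := ((l : ℝ) - m) * (l + m + 1)) ?_ ?_
  · rw [hlin, ultraOp_iterate_derivative_legendreP, ultraOp_sum]
    simp only [ultraOp_additionTerm]
    rw [Finset.sum_range_sub', additionRem, additionRem,
      iterate_derivative_legendreP_eq_zero (by omega)]
    simp
  · have h1 := iterate_derivative_legendreP_eval_one l m hm
    rw [eval_sub, eval_finsetSum, Finset.sum_range_succ', Finset.sum_eq_zero]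
    · simp only [additionTerm, eval_mul, eval_C, eval_pow, eval_sub, eval_one, eval_X, eval_comp]
      have hf : ((l + m)! : ℝ) ≠ 0 := by positivity
      have hf' : (m ! : ℝ) ≠ 0 := by positivity
      simp only [mul_zero, add_zero, pow_zero, mul_one, zero_add, Nat.factorial_zero, Nat.cast_one]
      rw [← h1] at hf ⊢
      have hf2 := left_ne_zero_of_mul hf
      have hf3 : ((l - m)! : ℝ) ≠ 0 := by positivity
      field_simp
      ring
    · intro b _
      simp [additionTerm]

theorem legendreP_addition_coeff {l m N : ℕ} (hm : m ≤ l) (hN : l < N) (t s : ℝ) :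
    ∑ b ∈ Finset.range N, ((1 - t ^ 2) * (1 - s ^ 2)) ^ b / ((m + b)! * b ! * 4 ^ b) *
        (derivative^[m + 2 * b] (legendreP l)).eval (t * s) =
      2 ^ m * (l - m)! / (l + m)! * (derivative^[m] (legendreP l)).eval t *
        (derivative^[m] (legendreP l)).eval s := by
  have h := congrArg (Polynomial.eval t) (sum_additionTerm hm hN s)
  rw [eval_finsetSum] at h
  simp only [additionTerm, eval_mul, eval_C, eval_pow, eval_sub, eval_one, eval_X, eval_comp] at h
  rw [mul_right_comm, ← h]
  refine Finset.sum_congr rfl fun b _ => ?_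
  rw [mul_pow, mul_comm t s]
  ring

end Addition

/-! ### The addition theorem for spherical harmonics -/

section SphericalHarmonic

open Polynomial

/-- A pair `(a, b)` is determined by `m = a - b`, the azimuthal order, and by `min a b`. The
vanishing hypothesis lets the right side run over a full rectangle. -/
theorem sum_range_antidiagonal_eq_sum_Icc {M : Type*} [AddCommMonoid M] (l : ℕ) (T : ℕ → ℕ → M)
    (hT : ∀ a b, l < a + b → T a b = 0) :
    ∑ k ∈ Finset.range (l + 1), ∑ p ∈ Finset.HasAntidiagonal.antidiagonal k, T p.1 p.2 =
      ∑ m ∈ Finset.Icc (-(l : ℤ)) l, ∑ b ∈ Finset.range (l + 1),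
        T (m.toNat + b) ((-m).toNat + b) := by
  rw [Finset.sum_sigma', Finset.sum_sigma']
  rw [← Finset.sum_filter_of_ne (s := (Finset.Icc (-(l : ℤ)) l).sigma fun _ => Finset.range (l + 1))
    (p := fun q => (q.1.toNat + q.2) + ((-q.1).toNat + q.2) ≤ l)
    (fun q _ hq => by by_contra h; exact hq (hT _ _ (not_le.1 h)))]
  refine Finset.sum_nbij' (fun q => ⟨(q.2.1 : ℤ) - q.2.2, min q.2.1 q.2.2⟩)
    (fun q => ⟨(q.1.toNat + q.2) + ((-q.1).toNat + q.2),
      (q.1.toNat + q.2, (-q.1).toNat + q.2)⟩) ?_ ?_ ?_ ?_ ?_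
  · rintro ⟨k, a, b⟩ h
    simp only [Finset.mem_sigma, Finset.mem_range, Finset.HasAntidiagonal.mem_antidiagonal, Finset.mem_filter,
      Finset.mem_Icc] at h ⊢
    omega
  · rintro ⟨m, b⟩ h
    simp only [Finset.mem_sigma, Finset.mem_range, Finset.HasAntidiagonal.mem_antidiagonal, Finset.mem_filter,
      Finset.mem_Icc] at h ⊢
    exact ⟨by omega, trivial⟩
  · rintro ⟨k, a, b⟩ h
    simp only [Finset.mem_sigma, Finset.mem_range, Finset.HasAntidiagonal.mem_antidiagonal] at h
    obtain ⟨hk, rfl⟩ := h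
    have e1 : ((a : ℤ) - b).toNat + min a b = a := by omega
    have e2 : (-((a : ℤ) - b)).toNat + min a b = b := by omega
    simp only [e1, e2]
  · rintro ⟨m, b⟩ h
    simp only [Sigma.mk.injEq, heq_eq_eq]
    constructor <;> omega
  · rintro ⟨k, a, b⟩ h
    have e1 : ((a : ℤ) - b).toNat + min a b = a := by omega
    have e2 : (-((a : ℤ) - b)).toNat + min a b = b := by omega
    simp only [e1, e2]

theorem eval_map_add_eq_sum_antidiagonal (l : ℕ) (P : ℝ[X]) (hP : P.natDegree ≤ l) (z : ℝ)
    (u v : ℂ) :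
    (P.map Complex.ofRealHom).eval (u + v + z) =
      ∑ k ∈ Finset.range (l + 1), ∑ p ∈ Finset.HasAntidiagonal.antidiagonal k,
        (((derivative^[p.1 + p.2] P).eval z : ℝ) : ℂ) * u ^ p.1 * v ^ p.2 / (p.1 ! * p.2 !) := by
  rw [← taylor_eval, eval_eq_sum_range' (n := l + 1)]
  · refine Finset.sum_congr rfl fun k _ => ?_
    rw [(Commute.all u v).add_pow', taylor_coeff, Finset.mul_sum]
    refine Finset.sum_congr rfl fun p hp => ?_
    obtain rfl := Finset.HasAntidiagonal.mem_antidiagonal.1 hp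
    have h1 : (((p.1 + p.2)! : ℕ) : ℂ) *
        eval (z : ℂ) (hasseDeriv (p.1 + p.2) (P.map Complex.ofRealHom)) =
        (((derivative^[p.1 + p.2] P).eval z : ℝ) : ℂ) := by
      have := congrFun (factorial_smul_hasseDeriv (R := ℂ) (p.1 + p.2)) (P.map Complex.ofRealHom)
      rw [iterate_derivative_map] at this
      have h2 := congrArg (eval (z : ℂ)) this
      rw [show (z : ℂ) = Complex.ofRealHom z from rfl, eval_map_apply] at h2
      simpa using h2
    rw [← h1, nsmul_eq_mul]
    have h3 : (((p.1 + p.2)! : ℕ) : ℂ) = (p.1 + p.2).choose p.1 * (p.1 ! * p.2 !) := by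
      rw [← Nat.add_choose_mul_factorial_mul_factorial, Nat.choose_symm_add]; push_cast; ring
    rw [h3]
    have h4 : (p.1 ! : ℂ) ≠ 0 := by exact_mod_cast Nat.factorial_ne_zero _
    have h5 : (p.2 ! : ℂ) ≠ 0 := by exact_mod_cast Nat.factorial_ne_zero _
    field_simp
  · rw [natDegree_taylor]
    exact Nat.lt_succ_of_le (natDegree_map_le.trans hP)

theorem natDegree_legendreP_le (l : ℕ) : (legendreP l).natDegree ≤ l := by
  rw [legendreP]
  refine (natDegree_C_mul_le _ _).trans ((natDegree_iterate_derivative _ _).trans ?_)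
  have h2 : ((X : ℝ[X]) ^ 2 - 1).natDegree ≤ 2 := by
    compute_degree
  have h3 : (((X : ℝ[X]) ^ 2 - 1) ^ l).natDegree ≤ l * 2 :=
    natDegree_pow_le.trans (Nat.mul_le_mul_left _ h2)
  omega

theorem norm_sq_eq_sum (x : R3) : ‖x‖ ^ 2 = x 0 ^ 2 + x 1 ^ 2 + x 2 ^ 2 := by
  rw [EuclideanSpace.norm_sq_eq, Fin.sum_univ_three]
  simp

theorem inner_eq_sum (x y : R3) : inner ℝ x y = x 0 * y 0 + x 1 * y 1 + x 2 * y 2 := by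
  rw [PiLp.inner_apply, Fin.sum_univ_three]
  simp [mul_comm]

/-- The phases `(-1)^m` cancel. At most one of `m.toNat`, `(-m).toNat` is nonzero, which treats both
signs of `m` at once. -/
theorem sphericalHarmonic_mul_conj (l : ℕ) (m : ℤ) (x y : R3) :
    sphericalHarmonic l m x * conj (sphericalHarmonic l m y) =
      (((2 * l + 1) / (4 * Real.pi) * ((l - m.natAbs)! / (l + m.natAbs)! *
        (derivative^[m.natAbs] (legendreP l)).eval (x 2) *
        (derivative^[m.natAbs] (legendreP l)).eval (y 2)) : ℝ) : ℂ) *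
      (((x 0 : ℂ) + Complex.I * x 1) * ((y 0 : ℂ) - Complex.I * y 1)) ^ m.toNat *
      (((x 0 : ℂ) - Complex.I * x 1) * ((y 0 : ℂ) + Complex.I * y 1)) ^ (-m).toNat := by
  have hsq : ((Real.sqrt ((2 * l + 1) / (4 * Real.pi) *
      (((l - m.natAbs)! : ℕ) / ((l + m.natAbs)! : ℕ))) : ℝ) : ℂ) *
      ((Real.sqrt ((2 * l + 1) / (4 * Real.pi) *
      (((l - m.natAbs)! : ℕ) / ((l + m.natAbs)! : ℕ))) : ℝ) : ℂ) =
      (((2 * l + 1) / (4 * Real.pi) * (((l - m.natAbs)! : ℕ) / ((l + m.natAbs)! : ℕ)) : ℝ) : ℂ) := by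
    rw [← Complex.ofReal_mul, Real.mul_self_sqrt (by positivity)]
  rw [sphericalHarmonic, sphericalHarmonic]
  rcases le_or_gt 0 m with h | h
  · have e1 : m.toNat = m.natAbs := by omega
    have e2 : (-m).toNat = 0 := by omega
    have hs : ((-1 : ℂ) ^ m.natAbs) * ((-1 : ℂ) ^ m.natAbs) = 1 := by
      rw [← mul_pow]; simp
    simp only [if_pos h, e1, e2, map_mul, map_pow, map_add, Complex.conj_ofReal, Complex.conj_I,
      map_neg, map_one, mul_pow]
    rw [Complex.ofReal_mul] at hsq ⊢
    rw [Complex.ofReal_mul, Complex.ofReal_mul]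
    linear_combination (norm := (push_cast; ring)) (
      (((derivative^[m.natAbs] (legendreP l)).eval (x 2) : ℝ) : ℂ) *
      (((derivative^[m.natAbs] (legendreP l)).eval (y 2) : ℝ) : ℂ) *
      ((x 0 : ℂ) + Complex.I * x 1) ^ m.natAbs * ((y 0 : ℂ) - Complex.I * y 1) ^ m.natAbs) *
      ((-1 : ℂ) ^ m.natAbs * (-1 : ℂ) ^ m.natAbs * hsq +
       (((2 * l + 1) / (4 * Real.pi) : ℝ) : ℂ) *
        ((((l - m.natAbs)! : ℕ) / ((l + m.natAbs)! : ℕ) : ℝ) : ℂ) * hs)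
  · have e1 : (-m).toNat = m.natAbs := by omega
    have e2 : m.toNat = 0 := by omega
    simp only [if_neg (not_le.2 h), e1, e2, map_mul, map_pow, map_sub, Complex.conj_ofReal,
      Complex.conj_I, map_one, mul_pow]
    rw [Complex.ofReal_mul] at hsq ⊢
    rw [Complex.ofReal_mul, Complex.ofReal_mul]
    linear_combination (norm := (push_cast; ring)) (
      (((derivative^[m.natAbs] (legendreP l)).eval (x 2) : ℝ) : ℂ) *
      (((derivative^[m.natAbs] (legendreP l)).eval (y 2) : ℝ) : ℂ) *
      ((x 0 : ℂ) - Complex.I * x 1) ^ m.natAbs * ((y 0 : ℂ) + Complex.I * y 1) ^ m.natAbs) * hsq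

/-- The addition theorem for spherical harmonics. -/
theorem sum_sphericalHarmonic_mul_conj (l : ℕ) {x y : R3} (hx : ‖x‖ = 1) (hy : ‖y‖ = 1) :
    ∑ m ∈ Finset.Icc (-(l : ℤ)) l, sphericalHarmonic l m x * conj (sphericalHarmonic l m y) =
      (((2 * l + 1) / (4 * Real.pi) * (legendreP l).eval (inner ℝ x y) : ℝ) : ℂ) := by
  -- In spherical angles `u = sin θ sin θ' e^{i(φ-φ')}` and `v` is its conjugate. Hence `x·y = u/2 +
  -- v/2 + x₂y₂`, the product `uv` depends only on the third coordinates, and `u^a v^b` has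
  -- frequency `a - b`.
  set u : ℂ := ((x 0 : ℂ) + Complex.I * x 1) * ((y 0 : ℂ) - Complex.I * y 1) with hu
  set v : ℂ := ((x 0 : ℂ) - Complex.I * x 1) * ((y 0 : ℂ) + Complex.I * y 1) with hv
  have hx2 : x 0 ^ 2 + x 1 ^ 2 + x 2 ^ 2 = 1 := by rw [← norm_sq_eq_sum, hx]; norm_num
  have hy2 : y 0 ^ 2 + y 1 ^ 2 + y 2 ^ 2 = 1 := by rw [← norm_sq_eq_sum, hy]; norm_num
  have huv : u * v = (((1 - x 2 ^ 2) * (1 - y 2 ^ 2) : ℝ) : ℂ) := by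
    rw [show 1 - x 2 ^ 2 = x 0 ^ 2 + x 1 ^ 2 by linarith,
      show 1 - y 2 ^ 2 = y 0 ^ 2 + y 1 ^ 2 by linarith]
    push_cast
    linear_combination (norm := (rw [hu, hv]; ring_nf))
      (-((x 1 : ℂ) ^ 2 * (y 0 : ℂ) ^ 2 + (x 0 : ℂ) ^ 2 * (y 1 : ℂ) ^ 2) +
        (Complex.I ^ 2 - 1) * (x 1 : ℂ) ^ 2 * (y 1 : ℂ) ^ 2) * Complex.I_sq
  have hin : ((inner ℝ x y : ℝ) : ℂ) = u / 2 + v / 2 + ((x 2 * y 2 : ℝ) : ℂ) := by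
    rw [inner_eq_sum]
    push_cast
    linear_combination (norm := (rw [hu, hv]; ring_nf)) (x 1 : ℂ) * (y 1 : ℂ) * Complex.I_sq
  have hP : (((legendreP l).eval (inner ℝ x y) : ℝ) : ℂ) =
      ((legendreP l).map Complex.ofRealHom).eval ((inner ℝ x y : ℝ) : ℂ) := by
    rw [show ((inner ℝ x y : ℝ) : ℂ) = Complex.ofRealHom (inner ℝ x y) from rfl, eval_map_apply]
    rfl
  rw [Complex.ofReal_mul, hP, hin,
    eval_map_add_eq_sum_antidiagonal l _ (natDegree_legendreP_le l),
    sum_range_antidiagonal_eq_sum_Icc l fun a b =>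
      (((derivative^[a + b] (legendreP l)).eval (x 2 * y 2) : ℝ) : ℂ) * (u / 2) ^ a * (v / 2) ^ b /
        (a ! * b !), Finset.mul_sum]
  · refine Finset.sum_congr rfl fun m hm => ?_
    rw [Finset.mem_Icc] at hm
    have hml : m.natAbs ≤ l := by omega
    rw [sphericalHarmonic_mul_conj, ← hu, ← hv, Complex.ofReal_mul, mul_assoc, mul_assoc]
    congr 1
    have key := legendreP_addition_coeff hml (Nat.lt_succ_self l) (x 2) (y 2)
    have h2 : ((l - m.natAbs)! : ℝ) / (l + m.natAbs)! *
        (derivative^[m.natAbs] (legendreP l)).eval (x 2) *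
        (derivative^[m.natAbs] (legendreP l)).eval (y 2) =
        (1 / 2) ^ m.natAbs * ∑ b ∈ Finset.range (l + 1),
        ((1 - x 2 ^ 2) * (1 - y 2 ^ 2)) ^ b / ((m.natAbs + b)! * b ! * 4 ^ b) *
        (derivative^[m.natAbs + 2 * b] (legendreP l)).eval (x 2 * y 2) := by
      rw [key, one_div, inv_pow]
      field_simp
    rw [h2, Complex.ofReal_mul, Complex.ofReal_sum, Finset.mul_sum, Finset.sum_mul]
    refine Finset.sum_congr rfl fun b _ => ?_
    have e3 : m.toNat + b + ((-m).toNat + b) = m.natAbs + 2 * b := by omega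
    have e4 : ((m.toNat + b)! : ℂ) * (((-m).toNat + b)! : ℂ) = (m.natAbs + b)! * b ! := by
      rcases le_or_gt 0 m with h | h
      · rw [show m.toNat = m.natAbs by omega, show (-m).toNat = 0 by omega, zero_add]
      · rw [show (-m).toNat = m.natAbs by omega, show m.toNat = 0 by omega, zero_add, mul_comm]
    have e5 : (1 / 2 : ℂ) ^ m.natAbs = (1 / 2) ^ m.toNat * (1 / 2) ^ (-m).toNat := by
      rw [← pow_add]; congr 1; omega
    rw [e3, e4, Complex.ofReal_mul, Complex.ofReal_div, Complex.ofReal_pow _ b, ← huv]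
    push_cast
    rw [e5, show (4 : ℂ) ^ b = 2 ^ b * 2 ^ b by rw [← mul_pow]; norm_num]
    rw [pow_add, pow_add, div_pow, div_pow, div_pow, div_pow, div_pow, div_pow, mul_pow]
    have h4 : ((m.natAbs + b)! : ℂ) ≠ 0 := by exact_mod_cast Nat.factorial_ne_zero _
    have h5 : (b ! : ℂ) ≠ 0 := by exact_mod_cast Nat.factorial_ne_zero _
    field_simp
    ring
  · intro a b hab
    rw [iterate_derivative_legendreP_eq_zero hab]
    simp

end SphericalHarmonic

/-! ### Polar coordinates and zonal integrals over the sphere -/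

section SphereIntegral

open Module

theorem integral_eq_integral_Ioi_toSphere {F : Type*} [NormedAddCommGroup F] [NormedSpace ℝ F]
    {f : R3 → F} (hf : Integrable f) :
    ∫ x, f x = ∫ r in Ioi (0 : ℝ), r ^ 2 •
      ∫ ω, f (r • (ω : R3)) ∂(volume : Measure R3).toSphere := by
  have hd : finrank ℝ R3 - 1 = 2 := by simp
  have hmp := (volume : Measure R3).measurePreserving_homeomorphUnitSphereProd
  rw [hd] at hmp
  have hemb := (homeomorphUnitSphereProd R3).measurableEmbedding
  let g : Metric.sphere (0 : R3) 1 × Ioi (0 : ℝ) → F := fun q => f ((q.2 : ℝ) • (q.1 : R3))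
  have hg : ∀ x : ({0}ᶜ : Set R3), g (homeomorphUnitSphereProd R3 x) = f x := by
    intro x
    have := homeomorphUnitSphereProd_symm_apply_coe R3 (homeomorphUnitSphereProd R3 x)
    rw [Homeomorph.symm_apply_apply] at this
    simp only [g, ← this]
  have hint : Integrable g
      ((volume : Measure R3).toSphere.prod (Measure.volumeIoiPow 2)) := by
    rw [← hmp.integrable_comp_emb hemb]
    have : IntegrableOn f ({0}ᶜ : Set R3) := hf.integrableOn
    rw [integrableOn_iff_comap_subtypeVal (measurableSet_singleton _).compl] at this
    exact this.congr (Filter.Eventually.of_forall fun x => (hg x).symm)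
  calc ∫ x, f x = ∫ x : ({0}ᶜ : Set R3), f x ∂((volume : Measure R3).comap (↑)) := by
        rw [integral_subtype_comap (measurableSet_singleton _).compl f,
          restrict_compl_singleton]
    _ = ∫ q, g q ∂((volume : Measure R3).toSphere.prod (Measure.volumeIoiPow 2)) := by
        rw [← hmp.integral_comp hemb]
        exact integral_congr_ae (Filter.Eventually.of_forall fun x => (hg x).symm)
    _ = ∫ r : Ioi (0 : ℝ), ∫ ω, f ((r : ℝ) • (ω : R3)) ∂(volume : Measure R3).toSphere
          ∂(Measure.volumeIoiPow 2) := integral_prod_symm _ hint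
    _ = _ := by
      simp only [Measure.volumeIoiPow, ENNReal.ofReal]
      rw [integral_withDensity_eq_integral_smul,
        integral_subtype_comap measurableSet_Ioi fun a : ℝ ↦ Real.toNNReal (a ^ 2) •
          ∫ ω, f (a • (ω : R3)) ∂(volume : Measure R3).toSphere,
        setIntegral_congr_fun measurableSet_Ioi fun x hx ↦ ?_]
      · rw [NNReal.smul_def, Real.coe_toNNReal _ (sq_nonneg _)]
      · exact (measurable_subtype_coe.pow_const _).real_toNNReal

theorem integral_pow_mul_exp_neg_sq_Ioi (n : ℕ) :
    ∫ t in Ioi (0 : ℝ), t ^ n * Real.exp (-t ^ 2) = Real.Gamma (((n : ℝ) + 1) / 2) / 2 := by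
  have h := integral_rpow_mul_exp_neg_mul_rpow (p := 2) (q := n) (b := 1) two_pos
    (by linarith [(Nat.cast_nonneg n : (0 : ℝ) ≤ n)]) one_pos
  simp only [Real.rpow_natCast, Real.rpow_ofNat, Real.one_rpow, neg_mul, one_mul] at h
  rw [h]
  ring

theorem integrable_pow_mul_exp_neg_mul_sq {b : ℝ} (hb : 0 < b) (n : ℕ) :
    Integrable fun t : ℝ => t ^ n * Real.exp (-b * t ^ 2) := by
  have := integrable_rpow_mul_exp_neg_mul_sq hb (s := n)
    (by linarith [(Nat.cast_nonneg n : (0 : ℝ) ≤ n)])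
  simpa only [Real.rpow_natCast] using this

theorem integral_pow_mul_exp_neg_sq (n : ℕ) :
    ∫ t : ℝ, t ^ n * Real.exp (-t ^ 2) =
      (1 + (-1) ^ n) / 2 * Real.Gamma (((n : ℝ) + 1) / 2) := by
  rcases Nat.even_or_odd n with hn | hn
  · have h := integral_comp_abs (f := fun t : ℝ => t ^ n * Real.exp (-t ^ 2))
    simp only [hn.pow_abs, sq_abs] at h
    rw [h, integral_pow_mul_exp_neg_sq_Ioi, hn.neg_one_pow]
    ring
  · have h := integral_neg_eq_self (fun t : ℝ => t ^ n * Real.exp (-t ^ 2)) volume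
    simp only [hn.neg_pow, neg_sq, neg_mul, integral_neg, one_pow] at h ⊢
    linarith

theorem integral_coord_pow_mul_exp_neg_norm_sq (n : ℕ) :
    ∫ x : R3, x 2 ^ n * Real.exp (-‖x‖ ^ 2) =
      Real.pi * ((1 + (-1) ^ n) / 2 * Real.Gamma (((n : ℝ) + 1) / 2)) := by
  let f : Fin 3 → ℝ → ℝ := ![fun t => Real.exp (-t ^ 2), fun t => Real.exp (-t ^ 2),
    fun t => t ^ n * Real.exp (-t ^ 2)]
  have h := integral_fintype_prod_volume_eq_prod (𝕜 := ℝ) f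
  rw [← (PiLp.volume_preserving_ofLp (Fin 3)).integral_comp
    (MeasurableEquiv.toLp 2 (Fin 3 → ℝ)).symm.measurableEmbedding] at h
  have hpi : ∫ t : ℝ, Real.exp (-t ^ 2) = Real.sqrt Real.pi := by
    simpa using integral_gaussian 1
  calc _ = ∫ x : R3, ∏ i, f i (x i) := by
        refine integral_congr_ae (Filter.Eventually.of_forall fun x => ?_)
        simp only [Fin.prod_univ_three, f, norm_sq_eq_sum, neg_add, Real.exp_add]
        simp
        ring
    _ = _ := by
        rw [h, Fin.prod_univ_three]
        simp only [f, Matrix.cons_val_zero, Matrix.cons_val_one, Matrix.cons_val, hpi,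
          integral_pow_mul_exp_neg_sq]
        rw [Real.mul_self_sqrt Real.pi_pos.le]

theorem integrable_coord_pow_mul_exp_neg_norm_sq (n : ℕ) :
    Integrable fun x : R3 => x 2 ^ n * Real.exp (-‖x‖ ^ 2) := by
  let f : Fin 3 → ℝ → ℝ := ![fun t => Real.exp (-t ^ 2), fun t => Real.exp (-t ^ 2),
    fun t => t ^ n * Real.exp (-t ^ 2)]
  have h0 : ∀ i, Integrable (f i) := by
    have h1 := integrable_pow_mul_exp_neg_mul_sq one_pos n
    have h2 := integrable_pow_mul_exp_neg_mul_sq one_pos 0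
    simp only [neg_mul, one_mul, pow_zero] at h1 h2
    intro i
    fin_cases i
    exacts [h2, h2, h1]
  have h := Integrable.fintype_prod (𝕜 := ℝ) h0
  rw [← volume_pi, ← (PiLp.volume_preserving_ofLp (Fin 3)).integrable_comp_emb
    (MeasurableEquiv.toLp 2 (Fin 3 → ℝ)).symm.measurableEmbedding] at h
  refine h.congr (Filter.Eventually.of_forall fun x => ?_)
  simp only [Function.comp_apply, Fin.prod_univ_three, f, norm_sq_eq_sum, neg_add, Real.exp_add]
  simp
  ring

/-- The integral of `x₂^n e^{-‖x‖²}` is computed in Cartesian and in polar coordinates; `Γ(s+1) =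
sΓ(s)` turns the quotient into the moment on `[-1, 1]`. -/
theorem integral_toSphere_coord_pow (n : ℕ) :
    ∫ ω, (ω : R3) 2 ^ n ∂(volume : Measure R3).toSphere =
      2 * Real.pi * ∫ t in (-1 : ℝ)..1, t ^ n := by
  have h := integral_eq_integral_Ioi_toSphere (integrable_coord_pow_mul_exp_neg_norm_sq n)
  rw [integral_coord_pow_mul_exp_neg_norm_sq] at h
  have h2 : ∀ r ∈ Ioi (0 : ℝ), r ^ 2 • ∫ ω, (r • (ω : R3)) 2 ^ n * Real.exp (-‖r • (ω : R3)‖ ^ 2)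
      ∂(volume : Measure R3).toSphere = (r ^ (n + 2) * Real.exp (-r ^ 2)) *
        ∫ ω, (ω : R3) 2 ^ n ∂(volume : Measure R3).toSphere := by
    intro r hr
    rw [smul_eq_mul, ← integral_const_mul, ← integral_const_mul]
    refine integral_congr_ae (Filter.Eventually.of_forall fun ω => ?_)
    have : ‖(ω : R3)‖ = 1 := by simp
    simp only [norm_smul, this, mul_one, Real.norm_eq_abs, sq_abs, PiLp.smul_apply, smul_eq_mul]
    ring
  rw [setIntegral_congr_fun measurableSet_Ioi h2, integral_mul_const,
    integral_pow_mul_exp_neg_sq_Ioi] at h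
  have hG : Real.Gamma ((((n + 2 : ℕ) : ℝ) + 1) / 2) =
      ((n : ℝ) + 1) / 2 * Real.Gamma (((n : ℝ) + 1) / 2) := by
    rw [← Real.Gamma_add_one (by positivity)]
    congr 1
    push_cast
    ring
  have hpos : 0 < Real.Gamma (((n : ℝ) + 1) / 2) := Real.Gamma_pos_of_pos (by positivity)
  rw [hG] at h
  rw [integral_pow, one_pow, pow_succ (-1 : ℝ) n]
  field_simp at h ⊢
  linarith

theorem integrable_toSphere_comp_coord {F : Type*} [NormedAddCommGroup F] {k : ℝ → F}
    (hk : Continuous k) :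
    Integrable (fun ω : Metric.sphere (0 : R3) 1 => k ((ω : R3) 2))
      (volume : Measure R3).toSphere := by
  have hc : Continuous fun ω : Metric.sphere (0 : R3) 1 => k ((ω : R3) 2) := by fun_prop
  have := hc.continuousOn.integrableOn_compact (μ := (volume : Measure R3).toSphere) isCompact_univ
  rwa [integrableOn_univ] at this

theorem integral_toSphere_eval_coord (p : Polynomial ℝ) :
    ∫ ω, p.eval ((ω : R3) 2) ∂(volume : Measure R3).toSphere =
      2 * Real.pi * ∫ t in (-1 : ℝ)..1, p.eval t := by
  simp only [Polynomial.eval_eq_sum_range]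
  rw [integral_finsetSum, intervalIntegral.integral_finsetSum, Finset.mul_sum]
  · refine Finset.sum_congr rfl fun i _ => ?_
    rw [integral_const_mul, intervalIntegral.integral_const_mul, integral_toSphere_coord_pow]
    ring
  · intro i _
    exact Continuous.intervalIntegrable (by fun_prop) _ _
  · intro i _
    exact integrable_toSphere_comp_coord (k := fun t => p.coeff i * t ^ i) (by fun_prop)

theorem abs_coord_le_one (ω : Metric.sphere (0 : R3) 1) : |(ω : R3) 2| ≤ 1 := by
  have h : ‖(ω : R3)‖ = 1 := by simp
  exact (PiLp.norm_apply_le (ω : R3) 2).trans h.le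

/-- Archimedes' theorem: the coordinate `n₂` is uniformly distributed over the unit sphere. -/
theorem integral_toSphere_comp_coord_real {k : ℝ → ℝ} (hk : Continuous k) :
    ∫ ω, k ((ω : R3) 2) ∂(volume : Measure R3).toSphere =
      2 * Real.pi * ∫ t in (-1 : ℝ)..1, k t := by
  set S := (volume : Measure R3).toSphere
  refine eq_of_forall_dist_le fun ε hε => ?_
  -- Total weight of the uniform error: the mass of the sphere plus `2π` times the length of `[-1,
  -- 1]`.
  set c : ℝ := S.real univ + 4 * Real.pi with hc
  have hc0 : 0 < c := by positivity
  obtain ⟨p, hp⟩ := exists_polynomial_near_of_continuousOn (-1) 1 k hk.continuousOn (ε / c)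
    (by positivity)
  have h1 : |(∫ ω, k ((ω : R3) 2) ∂S) - ∫ ω, p.eval ((ω : R3) 2) ∂S| ≤ ε / c * S.real univ := by
    rw [← integral_sub (integrable_toSphere_comp_coord hk)
      (integrable_toSphere_comp_coord p.continuous), ← Real.norm_eq_abs]
    refine norm_integral_le_of_norm_le_const (Filter.Eventually.of_forall fun ω => ?_)
    rw [Real.norm_eq_abs, abs_sub_comm]
    exact (hp _ (abs_le.1 (abs_coord_le_one ω))).le
  have h2 : |(∫ t in (-1 : ℝ)..1, p.eval t) - ∫ t in (-1 : ℝ)..1, k t| ≤ ε / c * 2 := by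
    rw [← intervalIntegral.integral_sub (p.continuous.intervalIntegrable _ _)
      (hk.intervalIntegrable _ _), ← Real.norm_eq_abs]
    refine (intervalIntegral.norm_integral_le_of_norm_le_const (C := ε / c) fun t ht => ?_).trans
      (by norm_num)
    rw [uIoc_of_le (by norm_num)] at ht
    exact (hp t ⟨ht.1.le, ht.2⟩).le
  rw [Real.dist_eq]
  calc _ = |((∫ ω, k ((ω : R3) 2) ∂S) - ∫ ω, p.eval ((ω : R3) 2) ∂S) +
        2 * Real.pi * ((∫ t in (-1 : ℝ)..1, p.eval t) - ∫ t in (-1 : ℝ)..1, k t)| := by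
        rw [integral_toSphere_eval_coord]
        congr 1
        ring
    _ ≤ ε / c * S.real univ + 2 * Real.pi * (ε / c * 2) := by
        refine (abs_add_le _ _).trans (add_le_add h1 ?_)
        rw [abs_mul, abs_of_pos (by positivity : 0 < 2 * Real.pi)]
        gcongr
    _ = ε / c * c := by rw [hc]; ring
    _ = ε := div_mul_cancel₀ _ hc0.ne'

theorem integral_toSphere_comp_coord {k : ℝ → ℂ} (hk : Continuous k) :
    ∫ ω, k ((ω : R3) 2) ∂(volume : Measure R3).toSphere =
      2 * Real.pi * ∫ t in (-1 : ℝ)..1, k t := by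
  have hre : Continuous fun t => (k t).re := Complex.continuous_re.comp hk
  have him : Continuous fun t => (k t).im := Complex.continuous_im.comp hk
  have e : ∀ t, k t = ((k t).re : ℂ) + ((k t).im : ℂ) * Complex.I := fun t =>
    (Complex.re_add_im _).symm
  have h1 : ∫ ω, k ((ω : R3) 2) ∂(volume : Measure R3).toSphere =
      ((∫ ω, (k ((ω : R3) 2)).re ∂(volume : Measure R3).toSphere : ℝ) : ℂ) +
      ((∫ ω, (k ((ω : R3) 2)).im ∂(volume : Measure R3).toSphere : ℝ) : ℂ) * Complex.I := by
    rw [← integral_complex_ofReal, ← integral_complex_ofReal, ← integral_mul_const,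
      ← integral_add]
    · simp only [← e]
    · exact (integrable_toSphere_comp_coord hre).ofReal
    · exact (integrable_toSphere_comp_coord him).ofReal.mul_const _
  have h2 : ∫ t in (-1 : ℝ)..1, k t = ((∫ t in (-1 : ℝ)..1, (k t).re : ℝ) : ℂ) +
      ((∫ t in (-1 : ℝ)..1, (k t).im : ℝ) : ℂ) * Complex.I := by
    rw [← intervalIntegral.integral_ofReal, ← intervalIntegral.integral_ofReal,
      ← intervalIntegral.integral_mul_const, ← intervalIntegral.integral_add]
    · simp only [← e]
    · exact Continuous.intervalIntegrable (by fun_prop) _ _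
    · exact Continuous.intervalIntegrable (by fun_prop) _ _
  rw [h1, h2, integral_toSphere_comp_coord_real hre, integral_toSphere_comp_coord_real him]
  push_cast
  ring

end SphereIntegral

/-! ### The Funk-Hecke formula for plane waves -/

section PlaneWaveIntegral

open Polynomial

theorem eval_iterate_derivative_sq_sub_one_pow {l j : ℕ} (hj : j < l) {t : ℝ} (ht : t ^ 2 = 1) :
    (derivative^[j] (((X : ℝ[X]) ^ 2 - 1) ^ l)).eval t = 0 := by
  obtain ⟨q, hq⟩ := pow_sub_dvd_iterate_derivative_pow ((X : ℝ[X]) ^ 2 - 1) l j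
  rw [hq, eval_mul, eval_pow, eval_sub, eval_pow, eval_X, eval_one, ht, sub_self,
    zero_pow (by omega), zero_mul]

/-- Repeated integration by parts: derivatives of order below `l` keep a factor `X² - 1`, so no
boundary term appears. -/
theorem integral_cexp_mul_iterate_derivative (c : ℂ) (l : ℕ) {k : ℕ} (hk : k ≤ l) :
    ∫ t in (-1 : ℝ)..1, Complex.exp (c * t) *
        (((derivative^[k] (((X : ℝ[X]) ^ 2 - 1) ^ l)).eval t : ℝ) : ℂ) =
      (-c) ^ k * ∫ t in (-1 : ℝ)..1, Complex.exp (c * t) * (((t ^ 2 - 1) ^ l : ℝ) : ℂ) := by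
  induction k with
  | zero => simp
  | succ k ih =>
    have hu : ∀ t : ℝ, HasDerivAt (fun t : ℝ => Complex.exp (c * t)) (c * Complex.exp (c * t)) t := by
      intro t
      have h := (((hasDerivAt_id (t : ℂ)).const_mul c).cexp).comp_ofReal
      simpa [mul_comm] using h
    have hv : ∀ t : ℝ, HasDerivAt
        (fun t : ℝ => (((derivative^[k] (((X : ℝ[X]) ^ 2 - 1) ^ l)).eval t : ℝ) : ℂ))
        (((derivative^[k + 1] (((X : ℝ[X]) ^ 2 - 1) ^ l)).eval t : ℝ) : ℂ) t := by
      intro t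
      rw [Function.iterate_succ_apply']
      exact (Polynomial.hasDerivAt _ t).ofReal_comp
    have h := intervalIntegral.integral_mul_deriv_eq_deriv_mul (a := -1) (b := 1)
      (fun t _ => hu t) (fun t _ => hv t)
      (Continuous.intervalIntegrable (by fun_prop) _ _)
      (Continuous.intervalIntegrable (by fun_prop) _ _)
    rw [h, eval_iterate_derivative_sq_sub_one_pow hk (by norm_num),
      eval_iterate_derivative_sq_sub_one_pow hk (by norm_num)]
    simp only [mul_assoc]
    rw [intervalIntegral.integral_const_mul, ih (by omega), pow_succ]
    simp only [Complex.ofReal_zero, mul_zero, sub_zero, zero_sub]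
    ring

/-- The weight is even, so averaging over `t` and `-t` leaves the cosine. -/
theorem integral_cexp_mul_one_sub_sq_pow (u : ℝ) (l : ℕ) :
    ∫ t in (-1 : ℝ)..1, Complex.exp (-(Complex.I * u) * t) * (((1 - t ^ 2) ^ l : ℝ) : ℂ) =
      ((∫ t in (-1 : ℝ)..1, Real.cos (u * t) * (1 - t ^ 2) ^ l : ℝ) : ℂ) := by
  have h := intervalIntegral.integral_comp_neg (a := -1) (b := 1)
    fun t : ℝ => Complex.exp (-(Complex.I * u) * t) * (((1 - t ^ 2) ^ l : ℝ) : ℂ)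
  rw [neg_neg] at h
  have h2 : ((∫ t in (-1 : ℝ)..1, Real.cos (u * t) * (1 - t ^ 2) ^ l : ℝ) : ℂ) =
      ∫ t in (-1 : ℝ)..1, (1 / 2 : ℂ) *
      (Complex.exp (-(Complex.I * u) * ((-t : ℝ) : ℂ)) * (((1 - (-t) ^ 2) ^ l : ℝ) : ℂ) +
        Complex.exp (-(Complex.I * u) * t) * (((1 - t ^ 2) ^ l : ℝ) : ℂ)) := by
    rw [← intervalIntegral.integral_ofReal]
    congr 1
    ext t
    rw [neg_sq, Complex.ofReal_mul, Complex.ofReal_cos, Complex.cos]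
    push_cast
    rw [show -(Complex.I * (u : ℂ)) * -(t : ℂ) = u * t * Complex.I by ring,
      show -(Complex.I * (u : ℂ)) * (t : ℂ) = -(u * t) * Complex.I by ring]
    ring
  rw [h2, intervalIntegral.integral_const_mul, intervalIntegral.integral_add, h]
  · ring
  · exact Continuous.intervalIntegrable (by fun_prop) _ _
  · exact Continuous.intervalIntegrable (by fun_prop) _ _

/-- Rodrigues' formula and `l` integrations by parts produce Poisson's integral. -/
theorem integral_cexp_mul_legendreP (u : ℝ) (l : ℕ) :
    ∫ t in (-1 : ℝ)..1, Complex.exp (-(Complex.I * u) * t) * (((legendreP l).eval t : ℝ) : ℂ) =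
      2 * (-Complex.I) ^ l * sphericalBessel l u := by
  have h := integral_cexp_mul_iterate_derivative (-(Complex.I * u)) l le_rfl
  have h1 : ∀ t : ℝ, Complex.exp (-(Complex.I * u) * t) * (((t ^ 2 - 1) ^ l : ℝ) : ℂ) =
      (-1) ^ l * (Complex.exp (-(Complex.I * u) * t) * (((1 - t ^ 2) ^ l : ℝ) : ℂ)) := by
    intro t
    rw [← neg_sub (1 : ℝ), neg_pow]
    push_cast
    ring
  have h2 : ∀ t : ℝ, Complex.exp (-(Complex.I * u) * t) * (((legendreP l).eval t : ℝ) : ℂ) =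
      (1 / (2 ^ l * (l ! : ℂ))) * (Complex.exp (-(Complex.I * u) * t) *
        (((derivative^[l] (((X : ℝ[X]) ^ 2 - 1) ^ l)).eval t : ℝ) : ℂ)) := by
    intro t
    rw [legendreP, eval_C_mul]
    push_cast
    ring
  simp only [h2]
  simp only [h1, intervalIntegral.integral_const_mul] at h ⊢
  rw [h, integral_cexp_mul_one_sub_sq_pow, sphericalBessel]
  have h3 : (-Complex.I) ^ l = (-1) ^ l * Complex.I ^ l := neg_pow _ _
  have h4 : (l ! : ℂ) ≠ 0 := by exact_mod_cast Nat.factorial_ne_zero _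
  push_cast
  rw [h3, neg_neg, mul_pow, pow_succ]
  field_simp

theorem norm_dir_le_one (x : R3) : ‖dir x‖ ≤ 1 := by
  rw [dir, norm_smul, norm_inv, norm_norm]
  exact inv_mul_le_one

theorem norm_dir {x : R3} (hx : x ≠ 0) : ‖dir x‖ = 1 := by
  rw [dir, norm_smul, norm_inv, norm_norm, inv_mul_cancel₀ (norm_ne_zero_iff.2 hx)]

theorem dir_smul {r : ℝ} (hr : 0 < r) {x : R3} (hx : ‖x‖ = 1) : dir (r • x) = x := by
  rw [dir, norm_smul, hx, mul_one, Real.norm_of_nonneg hr.le, smul_smul,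
    inv_mul_cancel₀ hr.ne', one_smul]

theorem measurable_dir : Measurable dir := by
  unfold dir
  fun_prop

theorem dir_map (T : R3 ≃ₗᵢ[ℝ] R3) (x : R3) : dir (T x) = T (dir x) := by
  rw [dir, dir, T.norm_map, map_smul]

theorem continuous_sphericalHarmonic (l : ℕ) (m : ℤ) : Continuous (sphericalHarmonic l m) := by
  unfold sphericalHarmonic
  split_ifs <;> fun_prop

/-- An integrable radial function times a continuous function of the direction times a phase is
integrable. -/
theorem integrable_phase_mul_radial_mul_comp_dir {β : ℝ → ℝ}
    (hβ : IntegrableOn (fun r => r ^ 2 * β r) (Ioi (0 : ℝ))) {Y : R3 → ℂ} (hY : Continuous Y)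
    {E : R3 → ℂ} (hE : Measurable E) (hE1 : ∀ x, ‖E x‖ ≤ 1) :
    Integrable fun x : R3 => E x * ((β ‖x‖ : ℂ) * Y (dir x)) := by
  have hβ' : Integrable (fun x : R3 => (β ‖x‖ : ℂ)) := by
    refine Integrable.ofReal ?_
    rw [integrable_fun_norm_addHaar (volume : Measure R3) (f := β)]
    simpa using hβ
  obtain ⟨c, hc⟩ := (isCompact_closedBall (0 : R3) 1).exists_bound_of_continuousOn hY.continuousOn
  refine Integrable.bdd_mul (c := 1) ?_ hE.aestronglyMeasurable (Filter.Eventually.of_forall hE1)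
  refine Integrable.mul_bdd (c := c) hβ'
    (hY.measurable.comp measurable_dir).aestronglyMeasurable
    (Filter.Eventually.of_forall fun x => hc _ ?_)
  simpa using norm_dir_le_one x

theorem norm_cexp_I_mul_ofReal (a : ℝ) : ‖Complex.exp (Complex.I * (a : ℂ))‖ ≤ 1 := by
  rw [mul_comm, Complex.norm_exp_ofReal_mul_I]

theorem integral_phase_mul_radial_mul_legendreP {β : ℝ → ℝ}
    (hβ : IntegrableOn (fun r => r ^ 2 * β r) (Ioi (0 : ℝ))) (l : ℕ) (g : ℝ) :
    ∫ x : R3, Complex.exp (Complex.I * ((-(g * x 2) : ℝ) : ℂ)) *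
        ((β ‖x‖ : ℂ) * (((legendreP l).eval (dir x 2) : ℝ) : ℂ)) =
      4 * Real.pi * (-Complex.I) ^ l * radialOverlap l g β := by
  rw [integral_eq_integral_Ioi_toSphere (integrable_phase_mul_radial_mul_comp_dir hβ
    (Y := fun x => (((legendreP l).eval (x 2) : ℝ) : ℂ)) (by fun_prop) (by fun_prop)
    fun x => norm_cexp_I_mul_ofReal _), radialOverlap, ← integral_complex_ofReal,
    ← integral_const_mul]
  refine setIntegral_congr_fun measurableSet_Ioi fun r hr => ?_
  have h1 : ∀ ω : Metric.sphere (0 : R3) 1,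
      Complex.exp (Complex.I * ((-(g * (r • (ω : R3)) 2) : ℝ) : ℂ)) *
        ((β ‖r • (ω : R3)‖ : ℂ) * (((legendreP l).eval (dir (r • (ω : R3)) 2) : ℝ) : ℂ)) =
      (β r : ℂ) * (Complex.exp (-(Complex.I * ((g * r : ℝ) : ℂ)) * ((ω : R3) 2 : ℂ)) *
        (((legendreP l).eval ((ω : R3) 2) : ℝ) : ℂ)) := by
    intro ω
    have hω : ‖(ω : R3)‖ = 1 := by simp
    rw [dir_smul hr hω, norm_smul, hω, mul_one, Real.norm_of_nonneg (le_of_lt hr),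
      PiLp.smul_apply, smul_eq_mul]
    rw [show Complex.I * ((-(g * (r * (ω : R3) 2)) : ℝ) : ℂ) =
      -(Complex.I * ((g * r : ℝ) : ℂ)) * ((ω : R3) 2 : ℂ) by push_cast; ring]
    ring
  simp only [h1]
  rw [integral_const_mul, integral_toSphere_comp_coord
    (k := fun t : ℝ => Complex.exp (-(Complex.I * ((g * r : ℝ) : ℂ)) * (t : ℂ)) *
      (((legendreP l).eval t : ℝ) : ℂ)) (by fun_prop), integral_cexp_mul_legendreP,
    Complex.real_smul]
  push_cast
  ring

/-- The rotation by the angle `θ` about the third axis. -/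
def rotation (θ : ℝ) : R3 ≃ₗᵢ[ℝ] R3 :=
  LinearIsometry.toLinearIsometryEquiv
    { toFun := fun x => !₂[Real.cos θ * x 0 - Real.sin θ * x 1,
        Real.sin θ * x 0 + Real.cos θ * x 1, x 2]
      map_add' := by
        intro x y
        ext i
        fin_cases i <;> simp <;> ring
      map_smul' := by
        intro c x
        ext i
        fin_cases i <;> simp <;> ring
      norm_map' := by
        intro x
        rw [← sq_eq_sq₀ (norm_nonneg _) (norm_nonneg _), norm_sq_eq_sum, norm_sq_eq_sum]
        simp
        linear_combination (x 0 ^ 2 + x 1 ^ 2) * Real.sin_sq_add_cos_sq θ } rfl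

theorem rotation_apply (θ : ℝ) (x : R3) :
    rotation θ x = !₂[Real.cos θ * x 0 - Real.sin θ * x 1,
        Real.sin θ * x 0 + Real.cos θ * x 1, x 2] := rfl

/-- Turning by `θ` multiplies `Y_lm` by `e^{imθ}`; the angle `π/|m|` makes this factor `-1`. -/
theorem sphericalHarmonic_rotation (l : ℕ) {m : ℤ} (hm : m ≠ 0) (x : R3) :
    sphericalHarmonic l m (rotation (Real.pi / m.natAbs) x) = -sphericalHarmonic l m x := by
  have hm' : (m.natAbs : ℂ) ≠ 0 := by exact_mod_cast Int.natAbs_ne_zero.2 hm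
  set θ : ℝ := Real.pi / m.natAbs with hθ
  have h1 : (Real.cos θ + Real.sin θ * Complex.I : ℂ) ^ m.natAbs = -1 := by
    push_cast
    rw [← Complex.exp_mul_I, ← Complex.exp_nat_mul, hθ]
    push_cast
    rw [← mul_assoc, mul_div_cancel₀ _ hm', Complex.exp_pi_mul_I]
  have h2 : (Real.cos θ - Real.sin θ * Complex.I : ℂ) ^ m.natAbs = -1 := by
    have := congrArg conj h1
    simpa only [map_pow, map_add, map_mul, Complex.conj_ofReal, Complex.conj_I, map_neg, map_one,
      mul_neg, ← sub_eq_add_neg] using this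
  rw [sphericalHarmonic, sphericalHarmonic, rotation_apply]
  simp only [Matrix.cons_val_zero, Matrix.cons_val_one, Matrix.cons_val]
  rcases le_or_gt 0 m with h | h
  · simp only [if_pos h]
    rw [show (((Real.cos θ * x 0 - Real.sin θ * x 1 : ℝ) : ℂ) +
        Complex.I * ((Real.sin θ * x 0 + Real.cos θ * x 1 : ℝ) : ℂ)) =
        (Real.cos θ + Real.sin θ * Complex.I : ℂ) * ((x 0 : ℂ) + Complex.I * (x 1 : ℂ)) by
      push_cast
      linear_combination (-(Complex.sin θ * x 1)) * Complex.I_sq, mul_pow, h1]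
    ring
  · simp only [if_neg (not_le.2 h)]
    rw [show (((Real.cos θ * x 0 - Real.sin θ * x 1 : ℝ) : ℂ) -
        Complex.I * ((Real.sin θ * x 0 + Real.cos θ * x 1 : ℝ) : ℂ)) =
        (Real.cos θ - Real.sin θ * Complex.I : ℂ) * ((x 0 : ℂ) - Complex.I * (x 1 : ℂ)) by
      push_cast
      linear_combination (-(Complex.sin θ * x 1)) * Complex.I_sq, mul_pow, h2]
    ring

theorem integral_comp_linearIsometryEquiv {F : Type*} [NormedAddCommGroup F] [NormedSpace ℝ F]
    (T : R3 ≃ₗᵢ[ℝ] R3) (f : R3 → F) : ∫ x, f (T x) = ∫ x, f x :=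
  T.measurePreserving.integral_comp T.toHomeomorph.measurableEmbedding f

/-- That rotation fixes `x₂` and the norm but flips the harmonic, so the integral equals its own
negative. -/
theorem integral_phase_mul_radial_mul_sphericalHarmonic_eq_zero (β : ℝ → ℝ) (l : ℕ) {m : ℤ}
    (hm : m ≠ 0) (g : ℝ) :
    ∫ x : R3, Complex.exp (Complex.I * ((-(g * x 2) : ℝ) : ℂ)) *
        ((β ‖x‖ : ℂ) * sphericalHarmonic l m (dir x)) = 0 := by
  have h := integral_comp_linearIsometryEquiv (rotation (Real.pi / m.natAbs)) fun x : R3 =>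
    Complex.exp (Complex.I * ((-(g * x 2) : ℝ) : ℂ)) *
        ((β ‖x‖ : ℂ) * sphericalHarmonic l m (dir x))
  simp only [dir_map, sphericalHarmonic_rotation l hm, LinearIsometryEquiv.norm_map,
    mul_neg, integral_neg] at h
  have h2 : ∀ x : R3, rotation (Real.pi / m.natAbs) x 2 = x 2 := fun x => by
    simp [rotation_apply]
  simp only [h2] at h
  linear_combination (-(1 / 2) : ℂ) * h

/-- The Funk-Hecke formula for plane waves, along the third axis. -/
theorem integral_phase_mul_radial_mul_legendreP_inner_aux {β : ℝ → ℝ}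
    (hβ : IntegrableOn (fun r => r ^ 2 * β r) (Ioi (0 : ℝ))) (l : ℕ) (g : ℝ) {y : R3}
    (hy : ‖y‖ = 1) :
    ∫ x : R3, Complex.exp (Complex.I * ((-(g * x 2) : ℝ) : ℂ)) *
        ((β ‖x‖ : ℂ) * (((legendreP l).eval (inner ℝ (dir x) y) : ℝ) : ℂ)) =
      4 * Real.pi * (-Complex.I) ^ l * (((legendreP l).eval (y 2) : ℝ) : ℂ) *
        radialOverlap l g β := by
  have hl : ((2 * l + 1 : ℝ) : ℂ) ≠ 0 := by
    have : (2 * l + 1 : ℝ) ≠ 0 := by positivity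
    exact_mod_cast this
  have hpi : (Real.pi : ℂ) ≠ 0 := by exact_mod_cast Real.pi_ne_zero
  have hint : ∀ m : ℤ, Integrable fun x : R3 => Complex.exp (Complex.I * ((-(g * x 2) : ℝ) : ℂ)) *
        ((β ‖x‖ : ℂ) * sphericalHarmonic l m (dir x)) := fun m =>
    integrable_phase_mul_radial_mul_comp_dir hβ (continuous_sphericalHarmonic l m) (by fun_prop)
      fun x => norm_cexp_I_mul_ofReal _
  have hae : ∀ᵐ x : R3, Complex.exp (Complex.I * ((-(g * x 2) : ℝ) : ℂ)) *
        ((β ‖x‖ : ℂ) * (((legendreP l).eval (inner ℝ (dir x) y) : ℝ) : ℂ)) =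
      ∑ m ∈ Finset.Icc (-(l : ℤ)) l, (4 * Real.pi / (2 * l + 1 : ℝ)) *
        conj (sphericalHarmonic l m y) * (Complex.exp (Complex.I * ((-(g * x 2) : ℝ) : ℂ)) *
        ((β ‖x‖ : ℂ) * sphericalHarmonic l m (dir x))) := by
    -- The addition theorem needs a unit vector and `dir 0 = 0`, so the null set `{0}` is discarded.
    filter_upwards [compl_mem_ae_iff.2 (measure_singleton (0 : R3))] with x hx
    have h := sum_sphericalHarmonic_mul_conj l (norm_dir hx) hy
    have h2 : (((legendreP l).eval (inner ℝ (dir x) y) : ℝ) : ℂ) =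
        (4 * Real.pi / (2 * l + 1 : ℝ)) * ∑ m ∈ Finset.Icc (-(l : ℤ)) l,
          sphericalHarmonic l m (dir x) * conj (sphericalHarmonic l m y) := by
      rw [h, Complex.ofReal_mul, Complex.ofReal_div, Complex.ofReal_mul 4]
      field_simp
      norm_num
    rw [h2, Finset.mul_sum, Finset.mul_sum, Finset.mul_sum]
    refine Finset.sum_congr rfl fun m _ => ?_
    ring
  rw [integral_congr_ae hae, integral_finsetSum _ fun m _ => (hint m).const_mul _]
  simp only [integral_const_mul]
  rw [Finset.sum_eq_single 0]
  · have h0 : ∀ x : R3, conj (sphericalHarmonic l 0 y) *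
        (Complex.exp (Complex.I * ((-(g * x 2) : ℝ) : ℂ)) *
          ((β ‖x‖ : ℂ) * sphericalHarmonic l 0 (dir x))) =
        ((2 * l + 1 : ℝ) / (4 * Real.pi)) * (((legendreP l).eval (y 2) : ℝ) : ℂ) *
        (Complex.exp (Complex.I * ((-(g * x 2) : ℝ) : ℂ)) *
          ((β ‖x‖ : ℂ) * (((legendreP l).eval (dir x 2) : ℝ) : ℂ))) := by
      intro x
      have h := sphericalHarmonic_mul_conj l 0 (dir x) y
      simp only [Int.natAbs_zero, Nat.sub_zero, add_zero, Int.toNat_zero, neg_zero, pow_zero,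
        mul_one, Function.iterate_zero_apply] at h
      rw [div_self (by positivity), one_mul] at h
      push_cast at h ⊢
      linear_combination (Complex.exp (Complex.I * -((g : ℂ) * x 2)) * (β ‖x‖ : ℂ)) * h
    rw [mul_assoc, ← integral_const_mul]
    simp only [h0]
    rw [integral_const_mul, integral_phase_mul_radial_mul_legendreP hβ]
    field_simp
  · intro m _ hm
    rw [integral_phase_mul_radial_mul_sphericalHarmonic_eq_zero β l hm, mul_zero]
  · intro h
    exact absurd (Finset.mem_Icc.2 ⟨by omega, by omega⟩) h

/-- The Funk-Hecke formula for plane waves. -/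
theorem integral_phase_mul_radial_mul_legendreP_inner {β : ℝ → ℝ}
    (hβ : IntegrableOn (fun r => r ^ 2 * β r) (Ioi (0 : ℝ))) (l : ℕ) (g : ℝ) {e y : R3}
    (he : ‖e‖ = 1) (hy : ‖y‖ = 1) :
    ∫ x : R3, Complex.exp (Complex.I * ((-(inner ℝ (g • e) x) : ℝ) : ℂ)) *
        ((β ‖x‖ : ℂ) * (((legendreP l).eval (inner ℝ (dir x) y) : ℝ) : ℂ)) =
      4 * Real.pi * (-Complex.I) ^ l * (((legendreP l).eval (inner ℝ e y) : ℝ) : ℂ) *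
        radialOverlap l g β := by
  let e₃ : R3 := EuclideanSpace.single 2 1
  have he₃ : ‖e₃‖ = 1 := by simp [e₃]
  have hin : ∀ x : R3, inner ℝ e₃ x = x 2 := fun x => by
    rw [inner_eq_sum]
    simp [e₃]
  -- Reflection in the plane orthogonal to `e - e₃` exchanges `e` and `e₃`; it is the identity when
  -- they coincide.
  let T : R3 ≃ₗᵢ[ℝ] R3 := (Submodule.span ℝ {e - e₃})ᗮ.reflection
  have hT : T e = e₃ := Submodule.reflection_sub (he.trans he₃.symm)
  have h := integral_phase_mul_radial_mul_legendreP_inner_aux hβ l g (y := T y)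
    ((T.norm_map y).trans hy)
  rw [← integral_comp_linearIsometryEquiv T] at h
  simp only [← hin, ← hT, dir_map, LinearIsometryEquiv.inner_map_map,
    LinearIsometryEquiv.norm_map] at h
  simpa only [real_inner_smul_left] using h

end PlaneWaveIntegral

/-! ### Matrix elements for general radial functions -/

section NonlocalElement

theorem sum_integral_sphericalHarmonic_mul_conj {β : ℝ → ℝ}
    (hβ : IntegrableOn (fun r => r ^ 2 * β r) (Ioi (0 : ℝ))) (l : ℕ) (g : ℝ) {e y : R3}
    (he : ‖e‖ = 1) (hy : ‖y‖ = 1) :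
    ∑ m ∈ Finset.Icc (-(l : ℤ)) l,
      (∫ x : R3, Complex.exp (Complex.I * ((-(inner ℝ (g • e) x) : ℝ) : ℂ)) *
        ((β ‖x‖ : ℂ) * sphericalHarmonic l m (dir x))) * conj (sphericalHarmonic l m y) =
      (2 * l + 1) * (-Complex.I) ^ l * (((legendreP l).eval (inner ℝ e y) : ℝ) : ℂ) *
        radialOverlap l g β := by
  have hpi : (Real.pi : ℂ) ≠ 0 := by exact_mod_cast Real.pi_ne_zero
  have hint : ∀ m : ℤ, Integrable fun x : R3 =>
      Complex.exp (Complex.I * ((-(inner ℝ (g • e) x) : ℝ) : ℂ)) *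
        ((β ‖x‖ : ℂ) * sphericalHarmonic l m (dir x)) := fun m =>
    integrable_phase_mul_radial_mul_comp_dir hβ (continuous_sphericalHarmonic l m) (by fun_prop)
      fun x => norm_cexp_I_mul_ofReal _
  simp only [← integral_mul_const]
  rw [← integral_finsetSum _ fun m _ => (hint m).mul_const _]
  have hae : ∀ᵐ x : R3, (∑ m ∈ Finset.Icc (-(l : ℤ)) l,
      Complex.exp (Complex.I * ((-(inner ℝ (g • e) x) : ℝ) : ℂ)) *
        ((β ‖x‖ : ℂ) * sphericalHarmonic l m (dir x)) * conj (sphericalHarmonic l m y)) =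
      ((2 * l + 1) / (4 * Real.pi)) *
        (Complex.exp (Complex.I * ((-(inner ℝ (g • e) x) : ℝ) : ℂ)) *
        ((β ‖x‖ : ℂ) * (((legendreP l).eval (inner ℝ (dir x) y) : ℝ) : ℂ))) := by
    filter_upwards [compl_mem_ae_iff.2 (measure_singleton (0 : R3))] with x hx
    have h := sum_sphericalHarmonic_mul_conj l (norm_dir hx) hy
    simp only [mul_assoc]
    rw [← Finset.mul_sum, ← Finset.mul_sum, h]
    push_cast
    ring
  rw [integral_congr_ae hae, integral_const_mul,
    integral_phase_mul_radial_mul_legendreP_inner hβ l g he hy]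
  field_simp

/-- The sum over `m` is moved inside the first integral, where the conjugate of the preceding
identity turns it into `P_l(x̂·e')`. Funk-Hecke then evaluates what remains. -/
theorem sum_integral_mul_conj_integral {β β' : ℝ → ℝ}
    (hβ : IntegrableOn (fun r => r ^ 2 * β r) (Ioi (0 : ℝ)))
    (hβ' : IntegrableOn (fun r => r ^ 2 * β' r) (Ioi (0 : ℝ))) (l : ℕ) (g g' : ℝ) {e e' : R3}
    (he : ‖e‖ = 1) (he' : ‖e'‖ = 1) :
    ∑ m ∈ Finset.Icc (-(l : ℤ)) l,
      (∫ x : R3, Complex.exp (Complex.I * ((-(inner ℝ (g • e) x) : ℝ) : ℂ)) *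
        ((β ‖x‖ : ℂ) * sphericalHarmonic l m (dir x))) *
      conj (∫ x : R3, Complex.exp (Complex.I * ((-(inner ℝ (g' • e') x) : ℝ) : ℂ)) *
        ((β' ‖x‖ : ℂ) * sphericalHarmonic l m (dir x))) =
      ((4 * Real.pi * ((2 * l + 1) * (legendreP l).eval (inner ℝ e e') *
        (radialOverlap l g β * radialOverlap l g' β')) : ℝ) : ℂ) := by
  have hint : ∀ m : ℤ, Integrable fun x : R3 =>
      Complex.exp (Complex.I * ((-(inner ℝ (g • e) x) : ℝ) : ℂ)) *
        ((β ‖x‖ : ℂ) * sphericalHarmonic l m (dir x)) := fun m =>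
    integrable_phase_mul_radial_mul_comp_dir hβ (continuous_sphericalHarmonic l m) (by fun_prop)
      fun x => norm_cexp_I_mul_ofReal _
  -- The second family becomes opaque constants, so that only the first integral absorbs them below.
  generalize hA : (fun m : ℤ =>
    ∫ x : R3, Complex.exp (Complex.I * ((-(inner ℝ (g' • e') x) : ℝ) : ℂ)) *
        ((β' ‖x‖ : ℂ) * sphericalHarmonic l m (dir x))) = A
  have hA' : ∀ m, (∫ x : R3, Complex.exp (Complex.I * ((-(inner ℝ (g' • e') x) : ℝ) : ℂ)) *
        ((β' ‖x‖ : ℂ) * sphericalHarmonic l m (dir x))) = A m := congrFun hA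
  have key : ∀ {y : R3}, ‖y‖ = 1 →
      ∑ m ∈ Finset.Icc (-(l : ℤ)) l, sphericalHarmonic l m y * conj (A m) =
      (2 * l + 1) * Complex.I ^ l * (((legendreP l).eval (inner ℝ y e') : ℝ) : ℂ) *
        radialOverlap l g' β' := by
    intro y hy
    have h := congrArg conj (sum_integral_sphericalHarmonic_mul_conj hβ' l g' he' hy)
    simp only [hA', map_sum, map_mul, map_pow, map_neg, Complex.conj_I, Complex.conj_ofReal,
      Complex.conj_conj, neg_neg, map_add, map_one, map_natCast, map_ofNat] at h
    rw [real_inner_comm, ← h]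
    exact Finset.sum_congr rfl fun m _ => mul_comm _ _
  simp only [hA', ← integral_mul_const]
  rw [← integral_finsetSum _ fun m _ => (hint m).mul_const _]
  have hae : ∀ᵐ x : R3, (∑ m ∈ Finset.Icc (-(l : ℤ)) l,
      Complex.exp (Complex.I * ((-(inner ℝ (g • e) x) : ℝ) : ℂ)) *
        ((β ‖x‖ : ℂ) * sphericalHarmonic l m (dir x)) * conj (A m)) =
      ((2 * l + 1) * Complex.I ^ l * radialOverlap l g' β') *
        (Complex.exp (Complex.I * ((-(inner ℝ (g • e) x) : ℝ) : ℂ)) *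
        ((β ‖x‖ : ℂ) * (((legendreP l).eval (inner ℝ (dir x) e') : ℝ) : ℂ))) := by
    filter_upwards [compl_mem_ae_iff.2 (measure_singleton (0 : R3))] with x hx
    simp only [mul_assoc]
    rw [← Finset.mul_sum, ← Finset.mul_sum, key (norm_dir hx)]
    ring
  rw [integral_congr_ae hae, integral_const_mul,
    integral_phase_mul_radial_mul_legendreP_inner hβ l g he he']
  have hI : Complex.I ^ l * (-Complex.I) ^ l = 1 := by
    rw [← mul_pow]; simp
  push_cast
  linear_combination (4 * Real.pi * ((2 * l + 1) * (((legendreP l).eval (inner ℝ e e') : ℝ) : ℂ) *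
        (radialOverlap l g β * radialOverlap l g' β'))) * hI

theorem exists_unit_direction (G : R3) :
    ∃ e : R3, ‖e‖ = 1 ∧ G = ‖G‖ • e ∧ (G ≠ 0 → e = dir G) := by
  by_cases hG : G = 0
  · exact ⟨EuclideanSpace.single 0 1, by simp, by simp [hG], fun h => absurd hG h⟩
  · refine ⟨dir G, norm_dir hG, ?_, fun _ => rfl⟩
    rw [dir, smul_smul, mul_inv_cancel₀ (norm_ne_zero_iff.2 hG), one_smul]

theorem radialOverlap_zero {l : ℕ} (hl : l ≠ 0) (β : ℝ → ℝ) : radialOverlap l 0 β = 0 := by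
  simp [radialOverlap, sphericalBessel, hl]

theorem legendreP_zero : legendreP 0 = 1 := by
  simp [legendreP]

/-- A zero wave vector has no direction, and an arbitrary unit vector stands in for it. The choice
is immaterial: `P_0` is constant, and for `l ≠ 0` the radial overlap at `0` vanishes. -/
theorem sum_integral_mul_conj_integral_dir {β β' : ℝ → ℝ}
    (hβ : IntegrableOn (fun r => r ^ 2 * β r) (Ioi (0 : ℝ)))
    (hβ' : IntegrableOn (fun r => r ^ 2 * β' r) (Ioi (0 : ℝ))) (l : ℕ) (G G' : R3) :
    ∑ m ∈ Finset.Icc (-(l : ℤ)) l,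
      (∫ x : R3, Complex.exp (Complex.I * ((-(inner ℝ G x) : ℝ) : ℂ)) *
        ((β ‖x‖ : ℂ) * sphericalHarmonic l m (dir x))) *
      conj (∫ x : R3, Complex.exp (Complex.I * ((-(inner ℝ G' x) : ℝ) : ℂ)) *
        ((β' ‖x‖ : ℂ) * sphericalHarmonic l m (dir x))) =
      ((4 * Real.pi * ((2 * l + 1) * (legendreP l).eval (inner ℝ (dir G) (dir G')) *
        (radialOverlap l ‖G‖ β * radialOverlap l ‖G'‖ β')) : ℝ) : ℂ) := by
  obtain ⟨e, he, hG, hd⟩ := exists_unit_direction G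
  obtain ⟨e', he', hG', hd'⟩ := exists_unit_direction G'
  have h := sum_integral_mul_conj_integral hβ hβ' l ‖G‖ ‖G'‖ he he'
  rw [← hG, ← hG'] at h
  rw [h]
  rcases eq_or_ne l 0 with rfl | hl
  · simp [legendreP_zero]
  · rcases eq_or_ne G 0 with h0 | h0
    · simp [h0, radialOverlap_zero hl]
    · rcases eq_or_ne G' 0 with h0' | h0'
      · simp [h0', radialOverlap_zero hl]
      · rw [hd h0, hd' h0']

theorem braket_planeWave_projector (Ω : ℝ) (G R : R3) (β : ℝ → ℝ) (l : ℕ) (m : ℤ) :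
    braket (planeWave Ω G) (projector β l m R) =
      ((1 / Real.sqrt Ω : ℝ) : ℂ) * Complex.exp (-(Complex.I * ((inner ℝ G R : ℝ) : ℂ))) *
      ∫ x : R3, Complex.exp (Complex.I * ((-(inner ℝ G x) : ℝ) : ℂ)) *
        ((β ‖x‖ : ℂ) * sphericalHarmonic l m (dir x)) := by
  rw [braket, ← integral_add_right_eq_self _ R, ← integral_const_mul]
  refine integral_congr_ae (Filter.Eventually.of_forall fun x => ?_)
  simp only [planeWave, projector, add_sub_cancel_right, map_mul, Complex.conj_ofReal,
    ← Complex.exp_conj, Complex.conj_I, inner_add_right, Complex.ofReal_add, mul_add, neg_mul,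
    Complex.ofReal_neg, mul_neg, Complex.exp_add]
  ring

theorem braket_conj_symm (f g : R3 → ℂ) : braket f g = conj (braket g f) := by
  rw [braket, braket, ← integral_conj]
  simp [mul_comm]

/-- The matrix elements between plane waves of a separable non-local operator, in terms of
Legendre polynomials and radial overlaps. -/
theorem nonlocalElement_eq {Ω : ℝ} (hΩ : 0 < Ω) (R Gp Gq : R3) {lmax n : ℕ}
    {β : ℕ → Fin n → ℝ → ℝ} (B : ℕ → Matrix (Fin n) (Fin n) ℝ)
    (hβ : ∀ l ≤ lmax, ∀ i, IntegrableOn (fun r => r ^ 2 * β l i r) (Ioi (0 : ℝ))) :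
    nonlocalElement Ω lmax n β B R Gp Gq =
      ((4 * Real.pi / Ω : ℝ) : ℂ) *
        Complex.exp (Complex.I * ((inner ℝ (Gq - Gp) R : ℝ) : ℂ)) *
        ((∑ l ∈ Finset.range (lmax + 1),
          (2 * (l : ℝ) + 1) * (legendreP l).eval (inner ℝ (dir Gp) (dir Gq)) *
            ∑ i, ∑ j, radialOverlap l ‖Gp‖ (β l i) * B l i j *
              radialOverlap l ‖Gq‖ (β l j) : ℝ) : ℂ) := by
  rw [nonlocalElement, Complex.ofReal_sum, Finset.mul_sum]
  refine Finset.sum_congr rfl fun l hl => ?_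
  have hl : l ≤ lmax := Nat.lt_succ_iff.1 (Finset.mem_range.1 hl)
  rw [Finset.sum_comm, Complex.ofReal_mul, Complex.ofReal_sum, Finset.mul_sum, Finset.mul_sum]
  refine Finset.sum_congr rfl fun i _ => ?_
  rw [Finset.sum_comm, Complex.ofReal_sum, Finset.mul_sum, Finset.mul_sum]
  refine Finset.sum_congr rfl fun j _ => ?_
  have h := sum_integral_mul_conj_integral_dir (hβ l hl i) (hβ l hl j) l Gp Gq
  have hΩ' : ((1 / Real.sqrt Ω : ℝ) : ℂ) * ((1 / Real.sqrt Ω : ℝ) : ℂ) = ((1 / Ω : ℝ) : ℂ) := by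
    rw [← Complex.ofReal_mul, div_mul_div_comm, one_mul, Real.mul_self_sqrt hΩ.le]
  have hexp : Complex.exp (Complex.I * ((inner ℝ (Gq - Gp) R : ℝ) : ℂ)) =
      Complex.exp (-(Complex.I * ((inner ℝ Gp R : ℝ) : ℂ))) *
      Complex.exp (Complex.I * ((inner ℝ Gq R : ℝ) : ℂ)) := by
    rw [← Complex.exp_add, inner_sub_left]
    congr 1
    push_cast
    ring
  have hterm : ∀ m : ℤ, braket (planeWave Ω Gp) (projector (β l i) l m R) * (B l i j : ℂ) *
      braket (projector (β l j) l m R) (planeWave Ω Gq) =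
      ((1 / Ω : ℝ) : ℂ) * Complex.exp (Complex.I * ((inner ℝ (Gq - Gp) R : ℝ) : ℂ)) *
        (B l i j : ℂ) *
      ((∫ x : R3, Complex.exp (Complex.I * ((-(inner ℝ Gp x) : ℝ) : ℂ)) *
        ((β l i ‖x‖ : ℂ) * sphericalHarmonic l m (dir x))) *
      conj (∫ x : R3, Complex.exp (Complex.I * ((-(inner ℝ Gq x) : ℝ) : ℂ)) *
        ((β l j ‖x‖ : ℂ) * sphericalHarmonic l m (dir x)))) := by
    intro m
    rw [braket_conj_symm (projector (β l j) l m R), braket_planeWave_projector,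
      braket_planeWave_projector, ← hΩ', hexp]
    simp only [map_mul, Complex.conj_ofReal, ← Complex.exp_conj, map_neg, Complex.conj_I,
      neg_mul, neg_neg]
    ring
  simp only [hterm]
  rw [← Finset.mul_sum, h]
  push_cast
  ring

end NonlocalElement

/-! ### Gaussian integrals of spherical Bessel functions -/

section Gaussian

/-- The entire function `x ↦ x^{-l} j_l(x)`. -/
def reducedBessel (l : ℕ) (x : ℝ) : ℝ :=
  1 / (2 ^ (l + 1) * (l ! : ℝ)) * ∫ t in (-1 : ℝ)..1, Real.cos (x * t) * (1 - t ^ 2) ^ l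

theorem sphericalBessel_eq (l : ℕ) (x : ℝ) :
    sphericalBessel l x = x ^ l * reducedBessel l x := by
  rw [sphericalBessel, reducedBessel]
  ring

theorem hasDerivAt_integral_cos_mul_one_sub_sq_pow (l : ℕ) (x : ℝ) :
    HasDerivAt (fun x : ℝ => ∫ t in (-1 : ℝ)..1, Real.cos (x * t) * (1 - t ^ 2) ^ l)
      (∫ t in (-1 : ℝ)..1, -(Real.sin (x * t) * t) * (1 - t ^ 2) ^ l) x := by
  refine (intervalIntegral.hasDerivAt_integral_of_dominated_loc_of_deriv_le
    (F' := fun x t => -(Real.sin (x * t) * t) * (1 - t ^ 2) ^ l) (bound := fun _ => 1)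
    Filter.univ_mem ?_ ?_ ?_ ?_ ?_ ?_).2
  · exact Filter.Eventually.of_forall fun y => Continuous.aestronglyMeasurable (by fun_prop)
  · exact Continuous.intervalIntegrable (by fun_prop) _ _
  · exact Continuous.aestronglyMeasurable (by fun_prop)
  · refine Filter.Eventually.of_forall fun t ht y _ => ?_
    rw [uIoc_of_le (by norm_num)] at ht
    have ht1 : |t| ≤ 1 := abs_le.2 ⟨ht.1.le, ht.2⟩
    have ht2 : t ^ 2 ≤ 1 := (sq_le_one_iff_abs_le_one t).2 ht1
    rw [norm_mul, norm_neg, norm_mul, norm_pow, Real.norm_eq_abs, Real.norm_eq_abs,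
      Real.norm_eq_abs, abs_of_nonneg (by linarith : 0 ≤ 1 - t ^ 2)]
    exact mul_le_one₀ (mul_le_one₀ (Real.abs_sin_le_one _) (abs_nonneg _) ht1)
      (pow_nonneg (by linarith) _)
      (pow_le_one₀ (by linarith) (by linarith [sq_nonneg t]))
  · exact Continuous.intervalIntegrable (by fun_prop) _ _
  · refine Filter.Eventually.of_forall fun t _ y _ => ?_
    have h := ((hasDerivAt_id y).mul_const t).cos
    simpa using h.mul_const ((1 - t ^ 2) ^ l)

/-- Integration by parts of `d/dt (t cos(xt))` against `(1-t²)^l`. The boundary terms `0 ^ l` matter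
only for `l = 0`, where the factor `l` in turn removes the truncated exponent `l - 1`. -/
theorem integral_cos_add_mul_deriv (l : ℕ) (x : ℝ) :
    (∫ t in (-1 : ℝ)..1, Real.cos (x * t) * (1 - t ^ 2) ^ l) +
      x * (∫ t in (-1 : ℝ)..1, -(Real.sin (x * t) * t) * (1 - t ^ 2) ^ l) =
    Real.cos x * 0 ^ l + Real.cos x * 0 ^ l +
      2 * l * ∫ t in (-1 : ℝ)..1, t * Real.cos (x * t) * (t * (1 - t ^ 2) ^ (l - 1)) := by
  have hv : ∀ t : ℝ, HasDerivAt (fun t : ℝ => t * Real.cos (x * t))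
      (Real.cos (x * t) - x * (Real.sin (x * t) * t)) t := by
    intro t
    have h := (hasDerivAt_id t).mul (((hasDerivAt_id t).const_mul x).cos)
    simp only [id, mul_one, one_mul] at h
    exact h.congr_deriv (by ring)
  have hu : ∀ t : ℝ, HasDerivAt (fun t : ℝ => (1 - t ^ 2) ^ l)
      (-(2 * l) * (t * (1 - t ^ 2) ^ (l - 1))) t := by
    intro t
    have h := (((hasDerivAt_id t).pow 2).const_sub 1).pow l
    exact h.congr_deriv (by simp; ring)
  have h := intervalIntegral.integral_mul_deriv_eq_deriv_mul (a := -1) (b := 1)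
      (fun t _ => hu t) (fun t _ => hv t)
      (Continuous.intervalIntegrable (by fun_prop) _ _)
      (Continuous.intervalIntegrable (by fun_prop) _ _)
  rw [← intervalIntegral.integral_const_mul, ← intervalIntegral.integral_add
    (Continuous.intervalIntegrable (by fun_prop) _ _)
    (Continuous.intervalIntegrable (by fun_prop) _ _)]
  rw [← intervalIntegral.integral_const_mul]
  calc _ = ∫ t in (-1 : ℝ)..1, (1 - t ^ 2) ^ l * (Real.cos (x * t) - x * (Real.sin (x * t) * t)) := by
        congr 1
        ext t
        ring
    _ = _ := by
        rw [h]
        have h2 : (∫ t in (-1 : ℝ)..1, -(2 * (l : ℝ)) * (t * (1 - t ^ 2) ^ (l - 1)) *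
            (t * Real.cos (x * t))) = -∫ t in (-1 : ℝ)..1, 2 * (l : ℝ) *
              (t * Real.cos (x * t) * (t * (1 - t ^ 2) ^ (l - 1))) := by
          rw [← intervalIntegral.integral_neg]
          congr 1
          ext t
          ring
        rw [h2]
        norm_num
        ring

theorem hasDerivAt_mul_reducedBessel_zero (G r : ℝ) :
    HasDerivAt (fun r : ℝ => r * reducedBessel 0 (G * r)) (Real.cos (G * r)) r := by
  have h1 := (hasDerivAt_integral_cos_mul_one_sub_sq_pow 0 (G * r)).comp r
    ((hasDerivAt_id r).const_mul G)
  have h2 := integral_cos_add_mul_deriv 0 (G * r)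
  have h3 := (hasDerivAt_id r).mul (h1.const_mul (1 / (2 ^ (0 + 1) * (0 ! : ℝ))))
  refine h3.congr_deriv ?_
  simp only [Function.comp_apply, id] at h2 ⊢
  norm_num at h2 ⊢
  linear_combination (1 / 2) * h2

/-- The classical `(x^{l+2} j_{l+1})' = x^{l+2} j_l` with the powers of `G` divided out, hence valid
at `G = 0` too. -/
theorem hasDerivAt_pow_mul_reducedBessel_succ (l : ℕ) (G r : ℝ) :
    HasDerivAt (fun r : ℝ => r ^ (2 * l + 3) * reducedBessel (l + 1) (G * r))
      (r ^ (2 * l + 2) * reducedBessel l (G * r)) r := by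
  have h1 := (hasDerivAt_integral_cos_mul_one_sub_sq_pow (l + 1) (G * r)).comp r
    ((hasDerivAt_id r).const_mul G)
  have h2 := integral_cos_add_mul_deriv (l + 1) (G * r)
  have h3 := ((hasDerivAt_id r).pow (2 * l + 3)).mul
    (h1.const_mul (1 / (2 ^ (l + 1 + 1) * ((l + 1)! : ℝ))))
  -- Uses `t²(1-t²)^l = (1-t²)^l - (1-t²)^{l+1}`.
  have h4 : (∫ t in (-1 : ℝ)..1, t * Real.cos (G * r * t) * (t * (1 - t ^ 2) ^ (l + 1 - 1))) =
      (∫ t in (-1 : ℝ)..1, Real.cos (G * r * t) * (1 - t ^ 2) ^ l) -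
      ∫ t in (-1 : ℝ)..1, Real.cos (G * r * t) * (1 - t ^ 2) ^ (l + 1) := by
    rw [← intervalIntegral.integral_sub (Continuous.intervalIntegrable (by fun_prop) _ _)
      (Continuous.intervalIntegrable (by fun_prop) _ _)]
    congr 1
    ext t
    rw [Nat.add_sub_cancel]
    ring
  refine h3.congr_deriv ?_
  rw [h4] at h2
  simp only [Function.comp_apply, Pi.pow_apply, id, reducedBessel, Nat.factorial_succ, mul_one,
    zero_pow (Nat.succ_ne_zero l), show 2 * l + 3 - 1 = 2 * l + 2 by omega] at h2 ⊢
  generalize (∫ t in (-1 : ℝ)..1, Real.cos (G * r * t) * (1 - t ^ 2) ^ l) = K at *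
  generalize (∫ t in (-1 : ℝ)..1, Real.cos (G * r * t) * (1 - t ^ 2) ^ (l + 1)) = K' at *
  generalize (∫ t in (-1 : ℝ)..1, -(Real.sin (G * r * t) * t) * (1 - t ^ 2) ^ (l + 1)) = D at *
  have hl : (l ! : ℝ) ≠ 0 := by positivity
  push_cast at h2 ⊢
  have hD : G * r * D = 2 * (l + 1) * (K - K') - K' := by linarith
  have h5 : (2 * (l : ℝ) + 3) * r ^ (2 * l + 2) * (1 / (2 ^ (l + 1 + 1) * (((l : ℝ) + 1) * l !)) * K')
      + r ^ (2 * l + 3) * (1 / (2 ^ (l + 1 + 1) * (((l : ℝ) + 1) * l !)) * (D * G)) =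
      r ^ (2 * l + 2) * (1 / (2 ^ (l + 1 + 1) * (((l : ℝ) + 1) * l !))) *
        ((2 * (l : ℝ) + 3) * K' + G * r * D) := by ring
  rw [h5, hD]
  field_simp
  ring

theorem continuous_reducedBessel (l : ℕ) : Continuous (reducedBessel l) :=
  continuous_iff_continuousAt.2 fun x =>
    ((hasDerivAt_integral_cos_mul_one_sub_sq_pow l x).const_mul _).continuousAt

theorem abs_reducedBessel_le (l : ℕ) (x : ℝ) :
    |reducedBessel l x| ≤ 1 / (2 ^ (l + 1) * (l ! : ℝ)) * 2 := by
  rw [reducedBessel, abs_mul, abs_of_pos (by positivity)]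
  gcongr
  rw [← Real.norm_eq_abs]
  refine (intervalIntegral.norm_integral_le_of_norm_le_const (C := 1) fun t ht => ?_).trans
    (by norm_num)
  rw [uIoc_of_le (by norm_num)] at ht
  have ht2 : t ^ 2 ≤ 1 := (sq_le_one_iff_abs_le_one t).2 (abs_le.2 ⟨ht.1.le, ht.2⟩)
  rw [norm_mul, norm_pow, Real.norm_eq_abs, Real.norm_eq_abs,
    abs_of_nonneg (by linarith : 0 ≤ 1 - t ^ 2)]
  exact mul_le_one₀ (Real.abs_cos_le_one _) (pow_nonneg (by linarith) _)
      (pow_le_one₀ (by linarith) (by linarith [sq_nonneg t]))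

theorem integrableOn_pow_mul_reducedBessel_mul_gaussian {b : ℝ} (hb : 0 < b) (l n : ℕ) (G : ℝ) :
    IntegrableOn (fun r : ℝ => r ^ n * reducedBessel l (G * r) * Real.exp (-b * r ^ 2))
      (Ioi 0) := by
  have h := (integrable_pow_mul_exp_neg_mul_sq hb n).bdd_mul
    (f := fun r => reducedBessel l (G * r))
    (((continuous_reducedBessel l).comp (continuous_const.mul continuous_id)).aestronglyMeasurable)
    (Filter.Eventually.of_forall fun r => abs_reducedBessel_le l (G * r))
  refine (h.congr (Filter.Eventually.of_forall fun r => ?_)).integrableOn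
  ring

theorem hasDerivAt_gaussian (b r : ℝ) :
    HasDerivAt (fun r : ℝ => Real.exp (-b * r ^ 2)) (-(2 * b * r) * Real.exp (-b * r ^ 2)) r := by
  have h := (((hasDerivAt_id r).pow 2).const_mul (-b)).exp
  exact h.congr_deriv (by simp; ring)

/-- Integration by parts. The boundary term vanishes at `0` because `f 0 = 0`, and at infinity
because both the product and its derivative are integrable. -/
theorem integral_eq_mul_integral_of_gaussian {b : ℝ} {f f' : ℝ → ℝ} (hf0 : f 0 = 0)
    (hf : ∀ r, HasDerivAt f (f' r) r)
    (h1 : IntegrableOn (fun r => f r * Real.exp (-b * r ^ 2)) (Ioi 0))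
    (h2 : IntegrableOn (fun r => f' r * Real.exp (-b * r ^ 2)) (Ioi 0))
    (h3 : IntegrableOn (fun r => r * f r * Real.exp (-b * r ^ 2)) (Ioi 0)) :
    ∫ r in Ioi (0 : ℝ), f' r * Real.exp (-b * r ^ 2) =
      2 * b * ∫ r in Ioi (0 : ℝ), r * f r * Real.exp (-b * r ^ 2) := by
  have hd : ∀ r, HasDerivAt (fun r => f r * Real.exp (-b * r ^ 2))
      (f' r * Real.exp (-b * r ^ 2) - 2 * b * (r * f r * Real.exp (-b * r ^ 2))) r := fun r =>
    ((hf r).mul (hasDerivAt_gaussian b r)).congr_deriv (by ring)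
  have hi := h2.sub (h3.const_mul (2 * b))
  have ht := tendsto_zero_of_hasDerivAt_of_integrableOn_Ioi (fun r _ => hd r) hi h1
  have h := integral_Ioi_of_hasDerivAt_of_tendsto' (fun r _ => hd r) hi ht
  rw [integral_sub h2 (h3.const_mul (2 * b)), integral_const_mul, hf0] at h
  linarith

/-- Half the real part of the Fourier transform of the Gaussian, by evenness. -/
theorem integral_cos_mul_gaussian {b : ℝ} (hb : 0 < b) (G : ℝ) :
    ∫ r in Ioi (0 : ℝ), Real.cos (G * r) * Real.exp (-b * r ^ 2) =
      Real.sqrt (Real.pi / b) / 2 * Real.exp (-G ^ 2 / (4 * b)) := by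
  have h := fourierIntegral_gaussian (b := b) (by simpa using hb) (G : ℂ)
  have h1 := congrArg Complex.re h
  have hint : Integrable fun x : ℝ =>
      Complex.exp (Complex.I * G * x) * Complex.exp (-b * (x : ℂ) ^ 2) := by
    refine Integrable.bdd_mul (c := 1) (integrable_cexp_neg_mul_sq (by simpa using hb))
      (Continuous.aestronglyMeasurable (by fun_prop)) (Filter.Eventually.of_forall fun x => ?_)
    rw [mul_assoc, ← Complex.ofReal_mul]
    exact norm_cexp_I_mul_ofReal _
  have h2 : (∫ x : ℝ, Complex.exp (Complex.I * G * x) * Complex.exp (-b * (x : ℂ) ^ 2)).re =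
      ∫ x : ℝ, Real.cos (G * x) * Real.exp (-b * x ^ 2) := by
    have h3 := integral_re hint
    rw [show (∫ x : ℝ, Complex.exp (Complex.I * G * x) * Complex.exp (-b * (x : ℂ) ^ 2)).re =
      RCLike.re (∫ x : ℝ, Complex.exp (Complex.I * G * x) * Complex.exp (-b * (x : ℂ) ^ 2)) from rfl,
      ← h3]
    congr 1
    ext x
    rw [show (-b * (x : ℂ) ^ 2 : ℂ) = ((-b * x ^ 2 : ℝ) : ℂ) by push_cast; ring,
      ← Complex.ofReal_exp, show Complex.I * (G : ℂ) * x = ((G * x : ℝ) : ℂ) * Complex.I by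
        push_cast; ring]
    rw [RCLike.re_eq_complex_re, Complex.re_mul_ofReal, Complex.exp_ofReal_mul_I_re]
  have h4 : ((Real.pi / b : ℂ) ^ (1 / 2 : ℂ) * Complex.exp (-(G : ℂ) ^ 2 / (4 * b))).re =
      Real.sqrt (Real.pi / b) * Real.exp (-G ^ 2 / (4 * b)) := by
    rw [show (-(G : ℂ) ^ 2 / (4 * b) : ℂ) = ((-G ^ 2 / (4 * b) : ℝ) : ℂ) by push_cast; ring,
      ← Complex.ofReal_exp, Complex.re_mul_ofReal, Real.sqrt_eq_rpow]
    congr 1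
    rw [show (Real.pi / b : ℂ) = ((Real.pi / b : ℝ) : ℂ) by push_cast; ring,
      show (1 / 2 : ℂ) = ((1 / 2 : ℝ) : ℂ) by push_cast; ring,
      ← Complex.ofReal_cpow (by positivity), Complex.ofReal_re]
  rw [h2, h4] at h1
  have h5 := integral_comp_abs (f := fun x : ℝ => Real.cos (G * x) * Real.exp (-b * x ^ 2))
  have h6 : ∀ x : ℝ, Real.cos (G * |x|) = Real.cos (G * x) := by
    intro x
    rw [← Real.cos_abs (G * |x|), ← Real.cos_abs (G * x), abs_mul, abs_mul, abs_abs]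
  simp only [h6, sq_abs] at h5
  linarith

/-- Each step in `l` costs one integration by parts, hence one factor `1/(2b)`; a first such step
reduces `l = 0` to the cosine integral. -/
theorem integral_pow_mul_reducedBessel_mul_gaussian {b : ℝ} (hb : 0 < b) (l : ℕ) (G : ℝ) :
    ∫ r in Ioi (0 : ℝ), r ^ (2 * l + 2) * reducedBessel l (G * r) * Real.exp (-b * r ^ 2) =
      Real.sqrt (Real.pi / b) / 2 * Real.exp (-G ^ 2 / (4 * b)) / (2 * b) ^ (l + 1) := by
  induction l with
  | zero =>
    have h := integral_eq_mul_integral_of_gaussian (b := b) (zero_mul (reducedBessel 0 (G * 0)))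
      (hasDerivAt_mul_reducedBessel_zero G) ?_ ?_ ?_
    · rw [integral_cos_mul_gaussian hb] at h
      rw [h, zero_add, pow_one, mul_div_cancel_left₀ _ (by positivity)]
      congr 1
      ext r
      ring
    · simpa using integrableOn_pow_mul_reducedBessel_mul_gaussian hb 0 1 G
    · refine ((integrable_pow_mul_exp_neg_mul_sq hb 0).bdd_mul (c := 1)
        (f := fun r => Real.cos (G * r)) (Continuous.aestronglyMeasurable (by fun_prop))
        (Filter.Eventually.of_forall fun r => Real.abs_cos_le_one _)).integrableOn.congr_fun
        (fun r _ => by simp) measurableSet_Ioi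
    · refine (integrableOn_pow_mul_reducedBessel_mul_gaussian hb 0 2 G).congr_fun
        (fun r _ => by simp only; ring) measurableSet_Ioi
  | succ l ih =>
    have h := integral_eq_mul_integral_of_gaussian (b := b)
      (f := fun r : ℝ => r ^ (2 * l + 3) * reducedBessel (l + 1) (G * r)) (by simp)
      (hasDerivAt_pow_mul_reducedBessel_succ l G)
      (integrableOn_pow_mul_reducedBessel_mul_gaussian hb _ _ _)
      (integrableOn_pow_mul_reducedBessel_mul_gaussian hb _ _ _)
      ((integrableOn_pow_mul_reducedBessel_mul_gaussian hb (l + 1) (2 * l + 4) G).congr_fun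
        (fun r _ => by simp only; ring) measurableSet_Ioi)
    rw [ih] at h
    rw [pow_succ (2 * b), ← div_div, h, mul_div_cancel_left₀ _ (by positivity)]
    congr 1
    ext r
    ring

end Gaussian

/-! ### Overlaps of the Hartwigsen-Goedecker-Hutter projectors -/

section HGH

open Polynomial

theorem radialOverlap_hghRadial {ρ : ℝ} (hρ : 0 < ρ) (l : ℕ) (G : ℝ) :
    radialOverlap l G (hghRadial ρ l 1) =
      hghConst ρ l 1 * G ^ l *
        (Real.sqrt (2 * Real.pi) / 2 * ρ ^ (2 * l + 3) * Real.exp (-G ^ 2 * ρ ^ 2 / 2)) := by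
  -- With `b = 1/(2ρ²)` the Gaussian is that of the projector, and `(2b)^{-(l+1)} = ρ^{2l+2}`.
  have hb : 0 < 1 / (2 * ρ ^ 2) := by positivity
  have h := integral_pow_mul_reducedBessel_mul_gaussian hb l G
  have h1 : Real.sqrt (Real.pi / (1 / (2 * ρ ^ 2))) = Real.sqrt (2 * Real.pi) * ρ := by
    rw [show Real.pi / (1 / (2 * ρ ^ 2)) = 2 * Real.pi * ρ ^ 2 by field_simp,
      Real.sqrt_mul (by positivity), Real.sqrt_sq hρ.le]
  have h2 : -G ^ 2 / (4 * (1 / (2 * ρ ^ 2))) = -G ^ 2 * ρ ^ 2 / 2 := by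
    field_simp
    ring
  have h3 : (2 * (1 / (2 * ρ ^ 2))) ^ (l + 1) = 1 / ρ ^ (2 * l + 2) := by
    rw [show 2 * (1 / (2 * ρ ^ 2)) = 1 / ρ ^ 2 by field_simp, div_pow, one_pow, ← pow_mul]
    ring_nf
  rw [h1, h2, h3] at h
  have h4 : ∀ r : ℝ, r ^ 2 * sphericalBessel l (G * r) * hghRadial ρ l 1 r =
      hghConst ρ l 1 * G ^ l * (r ^ (2 * l + 2) * reducedBessel l (G * r) *
        Real.exp (-(1 / (2 * ρ ^ 2)) * r ^ 2)) := by
    intro r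
    rw [sphericalBessel_eq, hghRadial, show l + 2 * 1 - 2 = l by omega,
      show -(1 / 2) * (r / ρ) ^ 2 = -(1 / (2 * ρ ^ 2)) * r ^ 2 by field_simp]
    ring
  simp only [radialOverlap, h4]
  rw [integral_const_mul, h]
  field_simp
  ring

theorem integrableOn_sq_mul_hghRadial {ρ : ℝ} (hρ : 0 < ρ) (l : ℕ) :
    IntegrableOn (fun r => r ^ 2 * hghRadial ρ l 1 r) (Ioi (0 : ℝ)) := by
  have hb : 0 < 1 / (2 * ρ ^ 2) := by positivity
  refine (((integrable_pow_mul_exp_neg_mul_sq hb (l + 2)).const_mul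
    (hghConst ρ l 1)).congr (Filter.Eventually.of_forall fun r => ?_)).integrableOn
  simp only
  rw [hghRadial, show l + 2 * 1 - 2 = l by omega,
    show -(1 / 2) * (r / ρ) ^ 2 = -(1 / (2 * ρ ^ 2)) * r ^ 2 by field_simp]
  ring

/-- Overlaps enter in pairs, so only the square matters, and it has an integer power of `ρ`. -/
theorem hghConst_sq {ρ : ℝ} (hρ : 0 < ρ) (l : ℕ) :
    hghConst ρ l 1 ^ 2 = 2 / (ρ ^ (2 * l + 3) * Real.Gamma ((l : ℝ) + 3 / 2) ^ 2) := by
  have h : (ρ ^ ((l : ℝ) + 3 / 2)) ^ 2 = ρ ^ (2 * l + 3) := by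
    rw [← Real.rpow_natCast, ← Real.rpow_mul hρ.le, ← Real.rpow_natCast]
    congr 1
    push_cast
    ring
  rw [hghConst, show ((l : ℝ) + (4 * ((1 : ℕ) : ℝ) - 1) / 2) = (l : ℝ) + 3 / 2 by norm_num,
    div_pow, mul_pow, h, Real.sq_sqrt (by norm_num)]

theorem radialOverlap_hghRadial_mul {ρ : ℝ} (hρ : 0 < ρ) (l : ℕ) (G G' : ℝ) :
    radialOverlap l G (hghRadial ρ l 1) * radialOverlap l G' (hghRadial ρ l 1) =
      Real.pi / Real.Gamma ((l : ℝ) + 3 / 2) ^ 2 * ρ ^ (2 * l + 3) * (G * G') ^ l *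
        Real.exp (-(G ^ 2 + G' ^ 2) * ρ ^ 2 / 2) := by
  have hΓ : Real.Gamma ((l : ℝ) + 3 / 2) ≠ 0 := (Real.Gamma_pos_of_pos (by positivity)).ne'
  rw [radialOverlap_hghRadial hρ, radialOverlap_hghRadial hρ,
    show -(G ^ 2 + G' ^ 2) * ρ ^ 2 / 2 = -G ^ 2 * ρ ^ 2 / 2 + -G' ^ 2 * ρ ^ 2 / 2 by ring,
    Real.exp_add]
  have h1 : Real.sqrt (2 * Real.pi) * Real.sqrt (2 * Real.pi) = 2 * Real.pi :=
    Real.mul_self_sqrt (by positivity)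
  calc _ = hghConst ρ l 1 ^ 2 * (Real.sqrt (2 * Real.pi) * Real.sqrt (2 * Real.pi)) / 4 *
      (ρ ^ (2 * l + 3)) ^ 2 * (G * G') ^ l * (Real.exp (-G ^ 2 * ρ ^ 2 / 2) *
        Real.exp (-G' ^ 2 * ρ ^ 2 / 2)) := by ring
    _ = _ := by
      rw [hghConst_sq hρ, h1]
      field_simp
      ring

theorem legendreP_one : legendreP 1 = X := by
  simp only [legendreP, Function.iterate_one, pow_one, derivative_sub, derivative_X_pow,
    derivative_one, Nat.factorial_one, Nat.cast_one, mul_one]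
  norm_num
  rw [← mul_assoc, ← C_mul]
  norm_num

theorem legendreP_two_eval (x : ℝ) : (legendreP 2).eval x = (3 * x ^ 2 - 1) / 2 := by
  rw [legendreP, show ((X : ℝ[X]) ^ 2 - 1) ^ 2 = X ^ 4 - 2 * X ^ 2 + 1 by ring]
  simp only [Function.iterate_succ_apply, Function.iterate_zero_apply, derivative_add,
    derivative_sub, derivative_mul, derivative_X_pow, derivative_one, derivative_ofNat]
  simp
  norm_num [Nat.factorial]
  ring

theorem norm_mul_norm_mul_inner_dir (x y : R3) :
    ‖x‖ * ‖y‖ * inner ℝ (dir x) (dir y) = inner ℝ x y := by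
  have h : ∀ z : R3, ‖z‖ • dir z = z := by
    intro z
    rcases eq_or_ne z 0 with rfl | hz
    · simp
    · rw [dir, smul_smul, mul_inv_cancel₀ (norm_ne_zero_iff.2 hz), one_smul]
  conv_rhs => rw [← h x, ← h y, real_inner_smul_left, real_inner_smul_right]
  ring

end HGH

end PlaneWavePP

end

/-! ### The two formulas -/

theorem mainTheorem4 (Ω : ℝ) (hΩ : 0 < Ω) (R Gp Gq : PlaneWavePP.R3) :
    (∀ (lmax n : ℕ) (β : ℕ → Fin n → ℝ → ℝ) (B : ℕ → Matrix (Fin n) (Fin n) ℝ),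
      (∀ l ≤ lmax, ∀ i, IntegrableOn (fun r => r ^ 2 * β l i r) (Ioi (0 : ℝ))) →
      PlaneWavePP.nonlocalElement Ω lmax n β B R Gp Gq =
        ((4 * Real.pi / Ω : ℝ) : ℂ) *
          Complex.exp (Complex.I * ((inner ℝ (Gq - Gp) R : ℝ) : ℂ)) *
          ((∑ l ∈ Finset.range (lmax + 1),
            (2 * (l : ℝ) + 1) *
              (PlaneWavePP.legendreP l).eval
                (inner ℝ (PlaneWavePP.dir Gp) (PlaneWavePP.dir Gq)) *
              ∑ i, ∑ j, PlaneWavePP.radialOverlap l ‖Gp‖ (β l i) * B l i j *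
                PlaneWavePP.radialOverlap l ‖Gq‖ (β l j) : ℝ) : ℂ)) ∧
    (∀ (r : ℕ → ℝ) (B : ℕ → Matrix (Fin 1) (Fin 1) ℝ), (∀ l ≤ 2, 0 < r l) →
      PlaneWavePP.nonlocalElement Ω 2 1 (fun l _ => PlaneWavePP.hghRadial (r l) l 1) B R Gp Gq =
        ((4 * Real.pi / Ω : ℝ) : ℂ) *
          Complex.exp (Complex.I * ((inner ℝ (Gq - Gp) R : ℝ) : ℂ)) *
          ((4 * B 0 0 0 * r 0 ^ 3 * Real.exp (-(‖Gp‖ ^ 2 + ‖Gq‖ ^ 2) * r 0 ^ 2 / 2) +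
            16 * B 1 0 0 * r 1 ^ 5 / 3 * inner ℝ Gp Gq *
              Real.exp (-(‖Gp‖ ^ 2 + ‖Gq‖ ^ 2) * r 1 ^ 2 / 2) +
            (32 * B 2 0 0 * r 2 ^ 7 / 15 * (inner ℝ Gp Gq) ^ 2 -
              32 * B 2 0 0 * r 2 ^ 7 / 45 * (‖Gp‖ * ‖Gq‖) ^ 2) *
              Real.exp (-(‖Gp‖ ^ 2 + ‖Gq‖ ^ 2) * r 2 ^ 2 / 2) : ℝ) : ℂ)) := by
  refine ⟨fun lmax n β B hβ => PlaneWavePP.nonlocalElement_eq hΩ R Gp Gq B hβ,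
    fun r B hr => ?_⟩
  rw [PlaneWavePP.nonlocalElement_eq hΩ R Gp Gq B
    fun l hl _ => PlaneWavePP.integrableOn_sq_mul_hghRadial (hr l hl) l]
  congr 2
  have h0 := PlaneWavePP.radialOverlap_hghRadial_mul (hr 0 (by norm_num)) 0 ‖Gp‖ ‖Gq‖
  have h1 := PlaneWavePP.radialOverlap_hghRadial_mul (hr 1 (by norm_num)) 1 ‖Gp‖ ‖Gq‖
  have h2 := PlaneWavePP.radialOverlap_hghRadial_mul (hr 2 le_rfl) 2 ‖Gp‖ ‖Gq‖
  have hs : Real.sqrt Real.pi ^ 2 = Real.pi := Real.sq_sqrt Real.pi_pos.le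
  -- `Γ(3/2) = √π/2`, `Γ(5/2) = 3√π/4`, `Γ(7/2) = 15√π/8`.
  have g0 : Real.Gamma (((0 : ℕ) : ℝ) + 3 / 2) ^ 2 = Real.pi / 4 := by
    have h := Real.Gamma_nat_add_one_add_half 0
    rw [show ((0 : ℕ) : ℝ) + 3 / 2 = ((0 : ℕ) : ℝ) + 1 + 1 / 2 by norm_num, h, div_pow, mul_pow, hs]
    norm_num [Nat.doubleFactorial]
  have g1 : Real.Gamma (((1 : ℕ) : ℝ) + 3 / 2) ^ 2 = 9 * Real.pi / 16 := by
    have h := Real.Gamma_nat_add_one_add_half 1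
    rw [show ((1 : ℕ) : ℝ) + 3 / 2 = ((1 : ℕ) : ℝ) + 1 + 1 / 2 by norm_num, h, div_pow, mul_pow, hs]
    norm_num [Nat.doubleFactorial]
  have g2 : Real.Gamma (((2 : ℕ) : ℝ) + 3 / 2) ^ 2 = 225 * Real.pi / 64 := by
    have h := Real.Gamma_nat_add_one_add_half 2
    rw [show ((2 : ℕ) : ℝ) + 3 / 2 = ((2 : ℕ) : ℝ) + 1 + 1 / 2 by norm_num, h, div_pow, mul_pow, hs]
    norm_num [Nat.doubleFactorial]
  have hπ := Real.pi_ne_zero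
  rw [g0, show Real.pi / (Real.pi / 4) = 4 by field_simp] at h0
  rw [g1, show Real.pi / (9 * Real.pi / 16) = 16 / 9 by field_simp] at h1
  rw [g2, show Real.pi / (225 * Real.pi / 64) = 64 / 225 by field_simp] at h2
  rw [← PlaneWavePP.norm_mul_norm_mul_inner_dir Gp Gq]
  simp only [Finset.sum_range_succ, Finset.sum_range_zero, Finset.univ_unique, Fin.default_eq_zero,
    Finset.sum_singleton, PlaneWavePP.legendreP_zero, PlaneWavePP.legendreP_one,
    PlaneWavePP.legendreP_two_eval, Polynomial.eval_one, Polynomial.eval_X, Nat.cast_zero,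
    Nat.cast_one, Nat.cast_ofNat, zero_add]
  generalize inner ℝ (PlaneWavePP.dir Gp) (PlaneWavePP.dir Gq) = c
  -- The coefficients are `(2l+1) P_l(c) B_l`. They give `3·16/9 = 16/3` for `l = 1` and
  -- `5·(64/225)(3c²-1)/2 = 32c²/15 - 32/45` for `l = 2`.
  linear_combination B 0 0 0 * h0 + 3 * c * B 1 0 0 * h1 +
    5 * ((3 * c ^ 2 - 1) / 2) * B 2 0 0 * h2
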